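/- Let $k\ge 1$. For a commutative ring $C$, the degenerate affine braid algebra $\mathcal{B}_k$ is the $C$-algebra generated by $t_u$ ($u\in S_k$), $\kappa_0,\kappa_1$, $y_1,\ldots,y_k$ with relations $t_1=1$, $t_ut_v=t_{uv}$, $y_iy_j=y_jy_i$, $\kappa_0\kappa_1=\kappa_1\kappa_0$, $\kappa_0y_i=y_i\kappa_0$, $\kappa_1y_i=y_i\kappa_1$, $\kappa_0t_{s_i}=t_{s_i}\kappa_0$, $\kappa_1t_{s_1}\kappa_1t_{s_1}=t_{s_1}\kappa_1t_{s_1}\kappa_1$, $\kappa_1t_{s_j}=t_{s_j}\kappa_1$ ($j\ne1$), $t_{s_i}(y_i+y_{i+1})=(y_i+y_{i+1})t_{s_i}$, $y_jt_{s_i}=t_{s_i}y_j$ ($j\neq i,i+1$), and $t_{s_i}t_{s_{i+1}}\gamma_{i,i+1}t_{s_{i+1}}t_{s_i}=\gamma_{i+1,i+2}$, where $\gamma_{i,i+1}=y_{i+1}-t_{s_i}y_it_{s_i}$. If $\frac12\in C$, put $\gamma_{0,1}=y_1-\frac12\kappa_1$, and define $\kappa_j$ ($1\le j\le k$) and $\gamma_{\ell,m}=\gamma_{m,\ell}$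 ($0\le \ell\neq m\le k$) by $t_w\kappa_it_{w^{-1}}=\kappa_{w(i)}$, $t_w\gamma_{i,j}t_{w^{-1}}=\gamma_{w(i),w(j)}$ with $w(0)=0$; put $c_j=\kappa_0+2(y_1+\cdots+y_j)$. Define $e_i$ ($1\le i\le k-1$) by $t_{s_i}y_i=y_{i+1}t_{s_i}-(1-e_i)$. For $\epsilon=\pm1$ and $z_0^{(\ell)}\in C$ ($\ell\ge0$), the degenerate affine BMW algebra $\mathcal{W}_k$ is the quotient of $\mathcal{B}_k$ by $$e_it_{s_i}=t_{s_i}e_i=\epsilon e_i,\quad e_it_{s_{i-1}}e_i=e_it_{s_{i+1}}e_i=\epsilon e_i,\quad e_1y_1^\ell e_1=z_0^{(\ell)}e_1,\quad e_i(y_i+y_{i+1})=0=(y_i+y_{i+1})e_i$$ (whenever the indices make sense), and the degenerate affine Hecke algebra $\mathcal{H}_k$ is the quotient of $\mathcal{W}_k$ by $e_i=0$ for all $i$. Let $\mathfrak{g}$ be a finite-dimensional complex Lie algebra with a nondegenerate symmetric $\mathrm{ad}$-invariant form, $\{b\}$ a basis of $\mathfrak g$ and $\{b^*\}$ the dual basis,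 $\kappa=\sum_b bb^*\in U\mathfrak g$, $\gamma=\sum_b b\otimes b^*$, and $C=Z(U\mathfrak g)$. For a $\mathfrak g$-module $M$ (of any dimension) and a finite-dimensional $\mathfrak g$-module $V$, let $\Phi:\mathcal{B}_k\to\mathrm{End}_{U\mathfrak g}(M\otimes V^{\otimes k})$ be the representation in which $z\in C$ acts as $z\otimes\mathrm{id}$, $t_w$ permutes the factors $V$, $\kappa_0$ is $\kappa$ acting on $M$, $\kappa_i$ is $\kappa$ acting on the $i$th factor $V$, $\gamma_{\ell,m}$ is $\gamma$ acting on the $\ell$th and $m$th factors (factor $0$ being $M$), and $c_j$ is $\kappa$ acting on $M$ and the first $j$ factors $V$; equivalently $y_j$ acts as $\frac12\kappa_j+\sum_{0\le\ell<j}\gamma_{\ell,j}$. (a) Let $\mathfrak g=\mathfrak{so}_{2r+1}$, $\mathfrak{sp}_{2r}$ or $\mathfrak{so}_{2r}$, the Lie algebra of $x\in\mathfrak{gl}(V)$ with $(xv,w)+(v,xw)=0$, where $\dim V=2r+1$, $2r$, $2r$ respectively and $(\,,)$ is a nondegenerate bilinear form on $V$ with $(v,w)=\epsilon(w,v)$,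 $\epsilon=1,-1,1$ respectively. Take the form $\langle x,y\rangle=\frac12\mathrm{tr}_V(xy)$ on $\mathfrak g$, and let $y=2r$, $2r+1$, $2r-1$ respectively. Then the elements $$z_0^{(\ell)}=\epsilon(\mathrm{id}\otimes\mathrm{tr}_V)\big((\tfrac12y+\gamma)^\ell\big),\qquad \ell\ge0,$$ (the power being taken in $U\mathfrak g\otimes\mathrm{End}(V)$) lie in $Z(U\mathfrak g)$, and $\Phi$ exists and factors through the degenerate affine BMW algebra $\mathcal{W}_k$ over $C=Z(U\mathfrak g)$ with parameters $\epsilon$ and $z_0^{(\ell)}$. (b) Let $\mathfrak g=\mathfrak{gl}(V)$, $\dim V=r$, with the form $\langle x,y\rangle=\mathrm{tr}_V(xy)$. Then $\Phi$ exists and factors through the degenerate affine Hecke algebra $\mathcal{H}_k$ (for every choice of the parameters $\epsilon=\pm 1$, $z_0^{(\ell)}\in C$ of $\mathcal{W}_k$). Let $\mathfrak g=\mathfrak{sl}(V)$, $\dim V=r\geq 1$, with the form $\langle x,y\rangle=\mathrm{tr}_V(xy)$. Then $\Phi$ exists, and there is a representation $\Phi':\mathcal{B}_k\to\mathrm{End}_{U\mathfrak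 g}(M\otimes V^{\otimes k})$ with $$\Phi'(t_w)=\Phi(t_w),\quad \Phi'(\gamma_{\ell,m})=\tfrac1r+\Phi(\gamma_{\ell,m}),\quad \Phi'(\kappa_i)=\Phi(\kappa_i),\quad \Phi'(z)=\Phi(z)\ (z\in C),$$ and it factors through $\mathcal{H}_k$ (again for every choice of the parameters). -/

import Mathlib

open scoped TensorProduct

attribute [local instance 100] LieRing.ofAssociativeRing

namespace DegBMW

noncomputable section

/-! ### The degenerate affine braid algebra and its quotients

Positions `1, …, k` are represented by `Fin k`, so `y_1` is `y 0`. -/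

/-- The generators `t_u` (`u ∈ S_k`), `κ₀`, `κ₁`, `y_1, …, y_k`. -/
inductive Gen (k : ℕ) : Type
  | t (u : Equiv.Perm (Fin k))
  | κ₀
  | κ₁
  | y (j : Fin k)

/-- The simple transposition exchanging the positions `i` and `i + 1` (counted from `0`). -/
def adj {k : ℕ} (i : ℕ) (h : i + 1 < k) : Equiv.Perm (Fin k) :=
  Equiv.swap ⟨i, by omega⟩ ⟨i + 1, h⟩

section Free

variable (C : Type*) [CommRing C] {k : ℕ}

/-- The free generator `t_u`. -/
def fT (u : Equiv.Perm (Fin k)) : FreeAlgebra C (Gen k) := FreeAlgebra.ι C (Gen.t u)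

/-- The free generator `κ₀`. -/
def fK0 : FreeAlgebra C (Gen k) := FreeAlgebra.ι C Gen.κ₀

/-- The free generator `κ₁`. -/
def fK1 : FreeAlgebra C (Gen k) := FreeAlgebra.ι C Gen.κ₁

/-- The free generator `y_j`. -/
def fY (j : Fin k) : FreeAlgebra C (Gen k) := FreeAlgebra.ι C (Gen.y j)

/-- The element `γ_{i,i+1} = y_{i+1} - t_{s_i} y_i t_{s_i}` of the free algebra. -/
def fGamma (i : ℕ) (h : i + 1 < k) : FreeAlgebra C (Gen k) :=
  fY C ⟨i + 1, h⟩ - fT C (adj i h) * fY C ⟨i, by omega⟩ * fT C (adj i h)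

/-- The defining relations of the degenerate affine braid algebra. -/
inductive BraidRel : FreeAlgebra C (Gen k) → FreeAlgebra C (Gen k) → Prop
  | t_one : BraidRel (fT C 1) 1
  | t_mul (u v : Equiv.Perm (Fin k)) : BraidRel (fT C u * fT C v) (fT C (u * v))
  | y_comm (i j : Fin k) : BraidRel (fY C i * fY C j) (fY C j * fY C i)
  | κ₀_κ₁ : BraidRel (fK0 C * fK1 C) (fK1 C * fK0 C)
  | κ₀_y (i : Fin k) : BraidRel (fK0 C * fY C i) (fY C i * fK0 C)
  | κ₁_y (i : Fin k) : BraidRel (fK1 C * fY C i) (fY C i * fK1 C)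
  | κ₀_t (i : ℕ) (h : i + 1 < k) :
      BraidRel (fK0 C * fT C (adj i h)) (fT C (adj i h) * fK0 C)
  | κ₁_t_first (h : 0 + 1 < k) :
      BraidRel (fK1 C * fT C (adj 0 h) * fK1 C * fT C (adj 0 h))
        (fT C (adj 0 h) * fK1 C * fT C (adj 0 h) * fK1 C)
  | κ₁_t (j : ℕ) (h : j + 1 < k) (hj : j ≠ 0) :
      BraidRel (fK1 C * fT C (adj j h)) (fT C (adj j h) * fK1 C)
  | t_y_add (i : ℕ) (h : i + 1 < k) :
      BraidRel (fT C (adj i h) * (fY C ⟨i, by omega⟩ + fY C ⟨i + 1, h⟩))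
        ((fY C ⟨i, by omega⟩ + fY C ⟨i + 1, h⟩) * fT C (adj i h))
  | y_t (j : Fin k) (i : ℕ) (h : i + 1 < k) (h₁ : (j : ℕ) ≠ i) (h₂ : (j : ℕ) ≠ i + 1) :
      BraidRel (fY C j * fT C (adj i h)) (fT C (adj i h) * fY C j)
  | γ_shift (i : ℕ) (h : i + 2 < k) :
      BraidRel
        (fT C (adj i (by omega)) * fT C (adj (i + 1) h) * fGamma C i (by omega) *
          fT C (adj (i + 1) h) * fT C (adj i (by omega)))
        (fGamma C (i + 1) h)

end Free

/-- The degenerate affine braid algebra `𝓑_k` over the commutative ring `C`. -/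
abbrev Braid (C : Type*) [CommRing C] (k : ℕ) : Type _ :=
  RingQuot (BraidRel C (k := k))

namespace Braid

variable (C : Type*) [CommRing C] {k : ℕ}

/-- The generator `t_u`. -/
def t (u : Equiv.Perm (Fin k)) : Braid C k := RingQuot.mkAlgHom C (BraidRel C) (fT C u)

/-- The generator `κ₀`. -/
def κ₀ : Braid C k := RingQuot.mkAlgHom C (BraidRel C) (fK0 C)

/-- The generator `κ₁`. -/
def κ₁ : Braid C k := RingQuot.mkAlgHom C (BraidRel C) (fK1 C)

/-- The generator `y_j`. -/
def y (j : Fin k) : Braid C k := RingQuot.mkAlgHom C (BraidRel C) (fY C j)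

/-- The elements `κ_0, …, κ_k`, with `κ_{w(1)} = t_w κ_1 t_{w⁻¹}`. -/
def κ [NeZero k] : Fin (k + 1) → Braid C k :=
  Fin.cases (κ₀ C) fun j => t C (Equiv.swap 0 j) * κ₁ C * t C (Equiv.swap 0 j)

/-- `γ_{0,1} = y_1 - ½ κ_1`. -/
def γ₀₁ [NeZero k] [Algebra ℂ C] : Braid C k :=
  y C 0 - algebraMap C _ (algebraMap ℂ C (1 / 2)) * κ₁ C

/-- `γ_{1,2} = y_2 - t_{s_1} y_1 t_{s_1}` (meaningful for `k ≥ 2`). -/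
def γ₁₂ [NeZero k] : Braid C k :=
  y C 1 - t C (Equiv.swap 0 1) * y C 0 * t C (Equiv.swap 0 1)

/-- For `i ≠ j`, a permutation sending the first position to `i` and the second to `j`. -/
def moveTo [NeZero k] (i j : Fin k) : Equiv.Perm (Fin k) :=
  Equiv.swap 0 i * Equiv.swap 1 (Equiv.swap 0 i j)

/-- The elements `γ_{ℓ,m}`, `0 ≤ ℓ, m ≤ k`, `ℓ ≠ m`, obtained from `γ_{0,1}` and `γ_{1,2}` through
`t_w γ_{ℓ,m} t_{w⁻¹} = γ_{w(ℓ),w(m)}` (where `w(0) = 0`) and `γ_{ℓ,m} = γ_{m,ℓ}`.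
The values for `ℓ = m` are not used. -/
def γ [NeZero k] [Algebra ℂ C] (ℓ m : Fin (k + 1)) : Braid C k :=
  Fin.cases
    (Fin.cases 0 (fun j => t C (Equiv.swap 0 j) * γ₀₁ C * t C (Equiv.swap 0 j)⁻¹) m)
    (fun i => Fin.cases
      (t C (Equiv.swap 0 i) * γ₀₁ C * t C (Equiv.swap 0 i)⁻¹)
      (fun j => t C (moveTo i j) * γ₁₂ C * t C (moveTo i j)⁻¹) m) ℓ

/-- The commuting elements `c_j = κ_0 + 2 (y_1 + ⋯ + y_j)`, `0 ≤ j ≤ k`. -/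
def c (j : Fin (k + 1)) : Braid C k :=
  κ₀ C + 2 * ∑ i : Fin k with i.val < j.val, y C i

/-- The elements `e_i`, defined by `t_{s_i} y_i = y_{i+1} t_{s_i} - (1 - e_i)`. -/
def e (i : ℕ) (h : i + 1 < k) : Braid C k :=
  t C (adj i h) * y C ⟨i, by omega⟩ - y C ⟨i + 1, h⟩ * t C (adj i h) + 1

end Braid

section Quotients

variable {C : Type*} [CommRing C] (k : ℕ) (ε : ℤˣ) (z : ℕ → C)

open Braid

/-- The relations of the degenerate affine BMW algebra, on top of those of `𝓑_k`. -/
inductive BMWRel : Braid C k → Braid C k → Prop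
  | e_t (i : ℕ) (h : i + 1 < k) : BMWRel (e C i h * t C (adj i h)) ((ε : ℤ) • e C i h)
  | t_e (i : ℕ) (h : i + 1 < k) : BMWRel (t C (adj i h) * e C i h) ((ε : ℤ) • e C i h)
  | e_t_pred_e (i : ℕ) (h : i + 1 + 1 < k) :
      BMWRel (e C (i + 1) h * t C (adj i (by omega)) * e C (i + 1) h)
        ((ε : ℤ) • e C (i + 1) h)
  | e_t_succ_e (i : ℕ) (h : i + 1 + 1 < k) :
      BMWRel (e C i (by omega) * t C (adj (i + 1) h) * e C i (by omega))
        ((ε : ℤ) • e C i (by omega))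
  | e_y_pow_e (h : 0 + 1 < k) (ℓ : ℕ) :
      BMWRel (e C 0 h * y C ⟨0, by omega⟩ ^ ℓ * e C 0 h) (z ℓ • e C 0 h)
  | e_y_add (i : ℕ) (h : i + 1 < k) :
      BMWRel (e C i h * (y C ⟨i, by omega⟩ + y C ⟨i + 1, h⟩)) 0
  | y_add_e (i : ℕ) (h : i + 1 < k) :
      BMWRel ((y C ⟨i, by omega⟩ + y C ⟨i + 1, h⟩) * e C i h) 0

/-- The degenerate affine BMW algebra `𝓦_k` with parameters `ε` and `z_0^{(ℓ)}`. -/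
abbrev BMW : Type _ := RingQuot (BMWRel k ε z)

/-- The quotient map `𝓑_k → 𝓦_k`. -/
def BMW.mk : Braid C k →ₐ[C] BMW k ε z := RingQuot.mkAlgHom C (BMWRel k ε z)

/-- The relations `e_i = 0` in the degenerate affine BMW algebra. -/
inductive HeckeRel : BMW k ε z → BMW k ε z → Prop
  | e_zero (i : ℕ) (h : i + 1 < k) : HeckeRel (BMW.mk k ε z (e C i h)) 0

/-- The degenerate affine Hecke algebra `𝓗_k`, the quotient of `𝓦_k` by the relations `e_i = 0`. -/
abbrev Hecke : Type _ := RingQuot (HeckeRel k ε z)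

/-- The quotient map `𝓦_k → 𝓗_k`. -/
def Hecke.mk : BMW k ε z →ₐ[C] Hecke k ε z := RingQuot.mkAlgHom C (HeckeRel k ε z)

end Quotients

/-! ### The action on `M ⊗ V^{⊗ k}` -/

section Action

variable (𝔤 : Type*) [LieRing 𝔤] [LieAlgebra ℂ 𝔤]

/-- The enveloping algebra `U𝔤`. -/
abbrev U : Type _ := UniversalEnvelopingAlgebra ℂ 𝔤

/-- The center `C = Z(U𝔤)`. -/
abbrev Z : Type _ := Subalgebra.center ℂ (U 𝔤)

/-- The action of `U𝔤` on a `𝔤`-module. -/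
def rep (M : Type*) [AddCommGroup M] [Module ℂ M] [LieRingModule 𝔤 M] [LieModule ℂ 𝔤 M] :
    U 𝔤 →ₐ[ℂ] Module.End ℂ M :=
  UniversalEnvelopingAlgebra.lift ℂ (LieModule.toEnd ℂ 𝔤 M)

variable {𝔤} in
/-- The element `γ = ∑ b ⊗ b^*` for a nondegenerate form `F` on `𝔤`; here `b` runs through a basis
of `𝔤` and `b^*` through its dual basis with respect to `F`. The sum does not depend on the
basis. -/
def gammaElt [FiniteDimensional ℂ 𝔤] (F : LinearMap.BilinForm ℂ 𝔤) (hF : F.Nondegenerate) :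
    U 𝔤 ⊗[ℂ] U 𝔤 :=
  ∑ i, UniversalEnvelopingAlgebra.ι ℂ (Module.finBasis ℂ 𝔤 i) ⊗ₜ[ℂ]
    UniversalEnvelopingAlgebra.ι ℂ (F.dualBasis hF (Module.finBasis ℂ 𝔤) i)

variable {𝔤} in
/-- The Casimir element `κ = ∑ b b^*`. -/
def casimir [FiniteDimensional ℂ 𝔤] (F : LinearMap.BilinForm ℂ 𝔤) (hF : F.Nondegenerate) : U 𝔤 :=
  ∑ i, UniversalEnvelopingAlgebra.ι ℂ (Module.finBasis ℂ 𝔤 i) *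
    UniversalEnvelopingAlgebra.ι ℂ (F.dualBasis hF (Module.finBasis ℂ 𝔤) i)

variable (M : Type*) [AddCommGroup M] [Module ℂ M] [LieRingModule 𝔤 M] [LieModule ℂ 𝔤 M]
variable (V : Type*) [AddCommGroup V] [Module ℂ V] [LieRingModule 𝔤 V] [LieModule ℂ 𝔤 V]
variable (k : ℕ)

/-- The space `M ⊗ V^{⊗ k}`. -/
abbrev TSpace (M : Type*) [AddCommGroup M] [Module ℂ M] (V : Type*) [AddCommGroup V] [Module ℂ V]
    (k : ℕ) : Type _ :=
  M ⊗[ℂ] (⨂[ℂ] _ : Fin k, V)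

variable {k} in
/-- An element of `U𝔤` acting in one tensor factor of `M ⊗ V^{⊗ k}`: the factor `0` is `M`, and
the factor `j.succ` is the `j`-th copy of `V`. -/
def slot (ℓ : Fin (k + 1)) : U 𝔤 →ₗ[ℂ] Module.End ℂ (TSpace M V k) :=
  Fin.cases
    (LinearMap.rTensorHom (⨂[ℂ] _ : Fin k, V) ∘ₗ (rep 𝔤 M).toLinearMap)
    (fun j => LinearMap.lTensorHom M ∘ₗ
      (PiTensorProduct.mapMultilinear ℂ (fun _ : Fin k => V) (fun _ => V)).toLinearMap
        (fun _ => LinearMap.id) j ∘ₗ (rep 𝔤 V).toLinearMap) ℓ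

variable {k} in
/-- An element of `U𝔤 ⊗ U𝔤` acting in the `ℓ`-th and `m`-th tensor factors (`ℓ ≠ m`). -/
def slot₂ (ℓ m : Fin (k + 1)) : U 𝔤 ⊗[ℂ] U 𝔤 →ₗ[ℂ] Module.End ℂ (TSpace M V k) :=
  LinearMap.mul' ℂ _ ∘ₗ TensorProduct.map (slot 𝔤 M V ℓ) (slot 𝔤 M V m)

variable {k} in
/-- The action of `x ∈ 𝔤` on `M` and the first `j` factors `V`. -/
def partialAct (j : Fin (k + 1)) (x : 𝔤) : Module.End ℂ (TSpace M V k) :=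
  ∑ ℓ : Fin (k + 1) with ℓ ≤ j, slot 𝔤 M V ℓ (UniversalEnvelopingAlgebra.ι ℂ x)

/-- `End_{U𝔤}(M ⊗ V^{⊗ k})`: the operators that commute with the action of `𝔤`. -/
def EndU : Subalgebra ℂ (Module.End ℂ (TSpace M V k)) :=
  Subalgebra.centralizer ℂ (Set.range (partialAct 𝔤 M V (Fin.last k)))

variable {k} in
/-- The permutation `w` of the tensor factors `V`. -/
def permOp (w : Equiv.Perm (Fin k)) : Module.End ℂ (TSpace M V k) :=
  LinearMap.lTensor M (PiTensorProduct.reindex ℂ (fun _ : Fin k => V) w).toLinearMap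

variable {𝔤 M V k}

/-- `Φ` is the representation of `𝓑_k` on `M ⊗ V^{⊗ k}`: `C = Z(U𝔤)` acts on `M`, `S_k` permutes the
factors `V`, `κ_j` is `κ` in the `j`-th factor, `γ_{ℓ,m}` is `γ` in the `ℓ`-th and `m`-th factors,
and `c_j` is `κ` acting on `M` and the first `j` factors `V`. -/
structure IsTensorRep [NeZero k] [FiniteDimensional ℂ 𝔤] (F : LinearMap.BilinForm ℂ 𝔤)
    (hF : F.Nondegenerate) (Φ : Braid (Z 𝔤) k →+* EndU 𝔤 M V k) : Prop where
  scalar (z : Z 𝔤) : (Φ (algebraMap (Z 𝔤) _ z)).val = slot 𝔤 M V 0 z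
  perm (w : Equiv.Perm (Fin k)) : (Φ (Braid.t _ w)).val = permOp M V w
  kappa (j : Fin (k + 1)) : (Φ (Braid.κ _ j)).val = slot 𝔤 M V j (casimir F hF)
  gamma (ℓ m : Fin (k + 1)) (h : ℓ ≠ m) :
    (Φ (Braid.γ _ ℓ m)).val = slot₂ 𝔤 M V ℓ m (gammaElt F hF)
  y (j : Fin k) : (Φ (Braid.y _ j)).val =
    (1 / 2 : ℂ) • slot 𝔤 M V j.succ (casimir F hF) +
      ∑ ℓ : Fin (k + 1) with ℓ < j.succ, slot₂ 𝔤 M V ℓ j.succ (gammaElt F hF)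
  c (j : Fin (k + 1)) : (Φ (Braid.c _ j)).val =
    ∑ i, partialAct 𝔤 M V j (Module.finBasis ℂ 𝔤 i) *
      partialAct 𝔤 M V j (F.dualBasis hF (Module.finBasis ℂ 𝔤) i)

/-- `Φ'` is obtained from `Φ` by `γ_{ℓ,m} ↦ a + Φ(γ_{ℓ,m})`, with `t_w`, `κ_j` and the scalars
acting as under `Φ`. -/
structure IsShift [NeZero k] (a : ℂ) (Φ Φ' : Braid (Z 𝔤) k →+* EndU 𝔤 M V k) : Prop where
  scalar (z : Z 𝔤) : Φ' (algebraMap (Z 𝔤) _ z) = Φ (algebraMap (Z 𝔤) _ z)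
  perm (w : Equiv.Perm (Fin k)) : Φ' (Braid.t _ w) = Φ (Braid.t _ w)
  kappa (j : Fin (k + 1)) : Φ' (Braid.κ _ j) = Φ (Braid.κ _ j)
  gamma (ℓ m : Fin (k + 1)) (h : ℓ ≠ m) :
    Φ' (Braid.γ _ ℓ m) = algebraMap ℂ _ a + Φ (Braid.γ _ ℓ m)

/-- `Φ` is a representation of the degenerate affine BMW algebra with parameters `ε`, `z`. -/
def FactorsBMW (ε : ℤˣ) (z : ℕ → Z 𝔤) (Φ : Braid (Z 𝔤) k →+* EndU 𝔤 M V k) : Prop :=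
  ∃ Ψ : BMW k ε z →+* EndU 𝔤 M V k, Ψ.comp (BMW.mk k ε z : Braid (Z 𝔤) k →+* BMW k ε z) = Φ

/-- `Φ` is a representation of the degenerate affine Hecke algebra, a quotient of the
degenerate affine BMW algebra with parameters `ε`, `z`. -/
def FactorsHecke (ε : ℤˣ) (z : ℕ → Z 𝔤) (Φ : Braid (Z 𝔤) k →+* EndU 𝔤 M V k) : Prop :=
  ∃ Ψ : Hecke k ε z →+* EndU 𝔤 M V k,
    (Ψ.comp (Hecke.mk k ε z : BMW k ε z →+* Hecke k ε z)).comp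
      (BMW.mk k ε z : Braid (Z 𝔤) k →+* BMW k ε z) = Φ

variable (V) in
/-- The element `ε (id ⊗ tr_V)((y/2 + γ)^ℓ)` of `U𝔤`, where the power is taken in
`U𝔤 ⊗ End(V)`. -/
def zParam [FiniteDimensional ℂ 𝔤] (F : LinearMap.BilinForm ℂ 𝔤) (hF : F.Nondegenerate)
    (ε : ℤˣ) (y : ℂ) (ℓ : ℕ) : U 𝔤 :=
  let X : U 𝔤 ⊗[ℂ] Module.End ℂ V :=
    (y / 2) • 1 + Algebra.TensorProduct.map (AlgHom.id ℂ (U 𝔤)) (rep 𝔤 V) (gammaElt F hF)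
  (ε : ℤ) • TensorProduct.rid ℂ (U 𝔤)
    (LinearMap.lTensor (U 𝔤) (LinearMap.trace ℂ V) (X ^ ℓ))

end Action

/-! ### The classical Lie algebras and their forms

The Lie algebra `𝔤𝔩(V)` is `Module.End ℂ V`; for a nondegenerate symmetric (skew-symmetric) bilinear
form `β` on `V`, the orthogonal (symplectic) Lie algebra is `skewAdjointLieSubalgebra β`. -/

/-- The three families `𝔰𝔬_{2r+1}`, `𝔰𝔭_{2r}` and `𝔰𝔬_{2r}`. -/
inductive Family : Type
  | soOdd
  | sp
  | soEven

/-- The dimension of the defining representation. -/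
def Family.dim : Family → ℕ → ℕ
  | soOdd, r => 2 * r + 1
  | sp, r => 2 * r
  | soEven, r => 2 * r

/-- The sign `ε`. -/
def Family.sign : Family → ℤˣ
  | soOdd => 1
  | sp => -1
  | soEven => 1

/-- The number `y`. -/
def Family.y : Family → ℕ → ℂ
  | soOdd, r => 2 * r
  | sp, r => 2 * r + 1
  | soEven, r => 2 * r - 1

section Classical

variable (V : Type*) [AddCommGroup V] [Module ℂ V]

/-- The Lie algebra `𝔰𝔩(V)` of endomorphisms of trace zero. -/
def sl : LieSubalgebra ℂ (Module.End ℂ V) :=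
  { LinearMap.ker (LinearMap.trace ℂ V) with
    lie_mem' := by
      intro x y _ _
      change LinearMap.trace ℂ V ⁅x, y⁆ = 0
      rw [LieRing.of_associative_ring_bracket, map_sub, LinearMap.trace_mul_comm, sub_self] }

theorem mem_sl (x : Module.End ℂ V) : x ∈ sl V ↔ LinearMap.trace ℂ V x = 0 := Iff.rfl

/-- The form `⟨x, y⟩ = tr_V(xy)` on `𝔤𝔩(V)`. -/
def glForm : LinearMap.BilinForm ℂ (Module.End ℂ V) := LieModule.traceForm ℂ (Module.End ℂ V) V

/-- The form `⟨x, y⟩ = tr_V(xy)` on `𝔰𝔩(V)`. -/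
def slForm : LinearMap.BilinForm ℂ (sl V) := LieModule.traceForm ℂ (sl V) V

variable {V}

/-- The form `⟨x, y⟩ = ½ tr_V(xy)` on the orthogonal or symplectic Lie algebra of `β`. -/
def soSpForm (β : LinearMap.BilinForm ℂ V) :
    LinearMap.BilinForm ℂ (skewAdjointLieSubalgebra β) :=
  (1 / 2 : ℂ) • LieModule.traceForm ℂ (skewAdjointLieSubalgebra β) V

theorem glForm_apply (x y : Module.End ℂ V) :
    glForm V x y = LinearMap.trace ℂ V (x * y) := by
  simp only [glForm, LieModule.traceForm_apply_apply, LieModule.toEnd_module_end]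
  rfl

theorem slForm_apply (x y : sl V) :
    slForm V x y = LinearMap.trace ℂ V ((x : Module.End ℂ V) * y) := by
  rfl

theorem soSpForm_apply (β : LinearMap.BilinForm ℂ V) (x y : skewAdjointLieSubalgebra β) :
    soSpForm β x y = (1 / 2 : ℂ) * LinearMap.trace ℂ V ((x : Module.End ℂ V) * y) := by
  rfl

variable [FiniteDimensional ℂ V]

theorem eq_zero_of_trace_mul (x : Module.End ℂ V)
    (h : ∀ z : Module.End ℂ V, LinearMap.trace ℂ V (x * z) = 0) : x = 0 := by
  ext v
  refine (Module.forall_dual_apply_eq_zero_iff ℂ (x v)).1 fun f => ?_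
  have h1 := h (LinearMap.smulRight f v)
  have h2 : x * LinearMap.smulRight f v = LinearMap.smulRight f (x v) := by
    ext w
    simp
  rwa [h2, LinearMap.trace_smulRight] at h1

theorem glForm_nondegenerate : (glForm V).Nondegenerate := by
  have hs : (glForm V).IsSymm := ⟨LieModule.traceForm_comm ℂ (Module.End ℂ V) V⟩
  refine (LinearMap.IsRefl.nondegenerate_iff_separatingLeft hs.isRefl).2 fun x hx => ?_
  exact eq_zero_of_trace_mul x fun z => by rw [← glForm_apply]; exact hx z

theorem slForm_nondegenerate : (slForm V).Nondegenerate := by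
  have hs : (slForm V).IsSymm := ⟨LieModule.traceForm_comm ℂ (sl V) V⟩
  refine (LinearMap.IsRefl.nondegenerate_iff_separatingLeft hs.isRefl).2 fun x hx => ?_
  rcases subsingleton_or_nontrivial V with hV | hV
  · exact Subtype.ext (Subsingleton.elim _ _)
  have hr : (Module.finrank ℂ V : ℂ) ≠ 0 := by
    exact_mod_cast (Module.finrank_pos (R := ℂ) (M := V)).ne'
  refine Subtype.ext (eq_zero_of_trace_mul _ fun z => ?_)
  have h1 := hx ⟨z - (LinearMap.trace ℂ V z / Module.finrank ℂ V) • 1, by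
    rw [mem_sl, map_sub, map_smul, LinearMap.trace_one, smul_eq_mul, div_mul_cancel₀ _ hr,
      sub_self]⟩
  rw [slForm_apply] at h1
  have h2 : LinearMap.trace ℂ V (x : Module.End ℂ V) = 0 := x.2
  simpa [mul_sub, h2] using h1

theorem soSpForm_nondegenerate (β : LinearMap.BilinForm ℂ V) (hβ : β.Nondegenerate) (ε : ℤˣ)
    (hε : ∀ v w, β v w = ((ε : ℤ) : ℂ) * β w v) : (soSpForm β).Nondegenerate := by
  have hs : (soSpForm β).IsSymm :=
    ⟨fun x y => by simp only [soSpForm_apply, LinearMap.trace_mul_comm ℂ (x : Module.End ℂ V) y]⟩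
  refine (LinearMap.IsRefl.nondegenerate_iff_separatingLeft hs.isRefl).2 fun x hx => ?_
  have hεε : ((ε : ℤ) : ℂ) * ((ε : ℤ) : ℂ) = 1 := by
    rcases Int.units_eq_one_or ε with rfl | rfl <;> simp
  let T := LinearMap.BilinForm.toDual β hβ
  let adj : Module.End ℂ V → Module.End ℂ V := fun z =>
    T.symm.conj (Module.Dual.transpose (R := ℂ) z)
  have hT : ∀ v w, T v w = β v w := fun v w => LinearMap.BilinForm.toDual_def hβ
  have hadj : ∀ z v w, β (adj z v) w = β v (z w) := by
    intro z v w
    rw [← hT]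
    simp [adj, LinearEquiv.conj_apply, hT, Module.Dual.transpose_apply]
  have hadj' : ∀ z v w, β v (adj z w) = β (z v) w := by
    intro z v w
    rw [hε v, hadj, hε w, ← mul_assoc, hεε, one_mul]
  have htr : ∀ z, LinearMap.trace ℂ V (adj z) = LinearMap.trace ℂ V z := by
    intro z
    rw [LinearMap.trace_conj', LinearMap.trace_transpose']
  have hskew : ∀ v w, β ((x : Module.End ℂ V) v) w = - β v ((x : Module.End ℂ V) w) := by
    intro v w
    have := x.2 v w
    simpa using this
  refine Subtype.ext (eq_zero_of_trace_mul _ fun z => ?_)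
  have hmem : z - adj z ∈ skewAdjointLieSubalgebra β := by
    intro v w
    simp only [LinearMap.sub_apply, LinearMap.neg_apply, map_sub, hadj, hadj']
    ring
  have h1 := hx ⟨z - adj z, hmem⟩
  rw [soSpForm_apply] at h1
  have h2 : adj (z * (x : Module.End ℂ V)) = - ((x : Module.End ℂ V) * adj z) := by
    ext v
    have hz : ∀ u, β u = 0 → u = 0 := fun u hu => hβ.1 u fun w => by rw [hu]; rfl
    refine sub_eq_zero.1 (hz _ ?_)
    ext w
    simp [hadj, hskew]
  have h3 := htr (z * (x : Module.End ℂ V))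
  rw [h2, map_neg, LinearMap.trace_mul_comm ℂ z] at h3
  simp only [mul_sub, map_sub] at h1
  linear_combination h1 - (1 / 2 : ℂ) * h3

end Classical
end

end DegBMW

/-!
The representation `Φ` is built from the operators `κ_ℓ` and `γ_{ℓ,m}` on the tensor factors rather
than from `y_1, …, y_k`. For a symmetric invariant form the tensor `γ = ∑ b ⊗ b^*` is symmetric and
commutes with the diagonal action of `𝔤`, and `κ` is central. It follows that the `κ_ℓ` commute
with each other and with the `γ_{ℓ,m}`, that the `γ_{ℓ,m}` satisfy the infinitesimal braid relation
`[γ_{ℓ,m}, γ_{ℓ,n} + γ_{m,n}] = 0` and commute when their indices are disjoint, and that `S_k`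
permutes the indices. These facts, collected in `BraidData`, imply the relations of `𝓑_k` for
`y_j = ½ κ_j + ∑_{ℓ < j} γ_{ℓ,j}`, and then `e_i` acts as `1 - γ_{i,i+1} t_{s_i}`. They are
insensitive to replacing `γ_{ℓ,m}` by `a + γ_{ℓ,m}`, which gives `Φ'` by the same construction
(`tensorRep`).

What remains is the action of `γ` on `V ⊗ V`. If the form is related to the trace of `V` by
`⟨p(x), y⟩ = tr(xy)` for a linear map `p : End(V) → 𝔤`, then `γ` acts as `∑ p(E_{ab}) ⊗ E_{ba}`
(`map_gammaElt_eq_twist`). For `p = id` this is the flip `s` of the two factors.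
* For `𝔤𝔩_r` one has `p = id`, and for `𝔰𝔩_r` one has `p(x) = x - tr(x)/r`. So `γ`, respectively
  `1/r + γ`, acts as `s`, and all `e_i` act by zero.
* For the orthogonal and symplectic Lie algebras `p = 1 - θ`, where `θ` is the adjoint with respect
  to the bilinear form. So `γ = s - Q`, where `Q` is the contraction of `V ⊗ V` by the form
  followed by the insertion of the dual tensor, and `e_i` acts as `ε Q`. The relations of `𝓦_k`
  come from `Qs = sQ = εQ`, from `Q (x ⊗ 1) Q = Q (1 ⊗ x) Q = tr(x) Q`, and, for `x ∈ 𝔤`, from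
  `(x ⊗ 1 + 1 ⊗ x) Q = 0 = Q (x ⊗ 1 + 1 ⊗ x)`. Since `κ` acts on `V` by `y = dim V - ε`, the
  element `y_1` is the image of `½ y + γ ∈ U𝔤 ⊗ End(V)`, and the trace identity for `Q` turns
  `e_1 y_1^ℓ e_1` into a partial trace, whence the parameters `z_0^{(ℓ)}`.
-/

namespace DegBMW

noncomputable section

/-! ### Representations of the braid algebra from commutation relations -/

/-- The action of a permutation of the positions `1, …, k` on the positions `0, 1, …, k`, fixing
the position `0`. -/
def extPerm {k : ℕ} (w : Equiv.Perm (Fin k)) : Equiv.Perm (Fin (k + 1)) where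
  toFun := Fin.cases 0 fun j => (w j).succ
  invFun := Fin.cases 0 fun j => (w⁻¹ j).succ
  left_inv := fun i => by cases i using Fin.cases <;> simp
  right_inv := fun i => by cases i using Fin.cases <;> simp

@[simp] theorem extPerm_zero {k : ℕ} (w : Equiv.Perm (Fin k)) : extPerm w 0 = 0 := rfl

@[simp] theorem extPerm_succ {k : ℕ} (w : Equiv.Perm (Fin k)) (j : Fin k) :
    extPerm w j.succ = (w j).succ := rfl

section Adj

variable {k : ℕ} (i : ℕ) (h : i + 1 < k)

theorem adj_mul_adj : adj i h * adj i h = 1 := Equiv.swap_mul_self _ _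

theorem adj_inv : (adj i h)⁻¹ = adj i h := Equiv.swap_inv _ _

theorem adj_left : adj i h ⟨i, by omega⟩ = ⟨i + 1, h⟩ := Equiv.swap_apply_left _ _

theorem adj_right : adj i h ⟨i + 1, h⟩ = ⟨i, by omega⟩ := Equiv.swap_apply_right _ _

theorem adj_of_ne {j : Fin k} (h₁ : (j : ℕ) ≠ i) (h₂ : (j : ℕ) ≠ i + 1) : adj i h j = j :=
  Equiv.swap_apply_of_ne_of_ne (by simpa [Fin.ext_iff]) (by simpa [Fin.ext_iff])

theorem extPerm_adj_of_lt {ℓ : Fin (k + 1)} (hℓ : (ℓ : ℕ) < i + 1) :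
    extPerm (adj i h) ℓ = ℓ := by
  cases ℓ using Fin.cases with
  | zero => rfl
  | succ j =>
    rw [Fin.val_succ] at hℓ
    rw [extPerm_succ, adj_of_ne] <;> omega

end Adj

theorem sum_filter_lt_succ {k : ℕ} {A : Type*} [AddCommMonoid A] (f : Fin (k + 1) → A) (i : ℕ)
    (h : i + 1 < k) : ∑ ℓ : Fin (k + 1) with ℓ < Fin.succ ⟨i + 1, h⟩, f ℓ =
      f (Fin.succ ⟨i, by omega⟩) + ∑ ℓ : Fin (k + 1) with ℓ < Fin.succ ⟨i, by omega⟩, f ℓ := by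
  have hs : (Finset.univ.filter fun ℓ : Fin (k + 1) => ℓ < Fin.succ ⟨i + 1, h⟩) =
      insert (Fin.succ ⟨i, by omega⟩)
        (Finset.univ.filter fun ℓ : Fin (k + 1) => ℓ < Fin.succ ⟨i, by omega⟩) := by
    ext ℓ
    simp only [Finset.mem_filter, Finset.mem_univ, true_and, Finset.mem_insert, Fin.lt_def,
      Fin.ext_iff, Fin.val_succ]
    omega
  rw [hs, Finset.sum_insert (by simp)]

/-- A presentation of the braid algebra in terms of the `κ_ℓ` and `γ_{ℓ,m}`: elements of a
`C`-algebra `A` satisfying relations from which those of `𝓑_k` follow. The relation `G_tri` is the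
infinitesimal braid relation. Nothing is required of `G ℓ ℓ`. -/
structure BraidData (C A : Type*) [CommRing C] [Ring A] [Algebra C A] (k : ℕ) where
  P : Equiv.Perm (Fin k) →* A
  K : Fin (k + 1) → A
  G : Fin (k + 1) → Fin (k + 1) → A
  K_comm (i j) : Commute (K i) (K j)
  K_G (i ℓ m) (h : ℓ ≠ m) : Commute (K i) (G ℓ m)
  P_K (w i) : P w * K i = K (extPerm w i) * P w
  P_G (w ℓ m) (h : ℓ ≠ m) : P w * G ℓ m = G (extPerm w ℓ) (extPerm w m) * P w
  G_symm (ℓ m) (h : ℓ ≠ m) : G ℓ m = G m ℓ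
  G_disj (ℓ m p q) (h₁ : ℓ ≠ m) (h₂ : p ≠ q) (h₃ : ℓ ≠ p) (h₄ : ℓ ≠ q) (h₅ : m ≠ p)
    (h₆ : m ≠ q) : Commute (G ℓ m) (G p q)
  G_tri (ℓ m n) (h₁ : ℓ ≠ m) (h₂ : ℓ ≠ n) (h₃ : m ≠ n) : Commute (G ℓ m) (G ℓ n + G m n)

namespace BraidData

section

variable {C A : Type*} [CommRing C] [Ring A] [Algebra C A] {k : ℕ} (D : BraidData C A k)

theorem P_adj_mul_self (i : ℕ) (h : i + 1 < k) : D.P (adj i h) * D.P (adj i h) = 1 := by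
  rw [← map_mul, adj_mul_adj, map_one]

theorem conj_K (w : Equiv.Perm (Fin k)) (i : Fin (k + 1)) :
    D.P w * D.K i * D.P w⁻¹ = D.K (extPerm w i) := by
  rw [D.P_K, mul_assoc, ← map_mul, mul_inv_cancel, map_one, mul_one]

theorem conj_G (w : Equiv.Perm (Fin k)) {ℓ m : Fin (k + 1)} (h : ℓ ≠ m) :
    D.P w * D.G ℓ m * D.P w⁻¹ = D.G (extPerm w ℓ) (extPerm w m) := by
  rw [D.P_G w ℓ m h, mul_assoc, ← map_mul, mul_inv_cancel, map_one, mul_one]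

theorem commute_P_G (i : ℕ) (h : i + 1 < k) : Commute (D.P (adj i h))
    (D.G (Fin.succ ⟨i, by omega⟩) (Fin.succ ⟨i + 1, h⟩)) := by
  have hne : (Fin.succ ⟨i, by omega⟩ : Fin (k + 1)) ≠ Fin.succ ⟨i + 1, h⟩ := by
    simp [Fin.ext_iff]
  have := D.P_G (adj i h) _ _ hne
  rwa [extPerm_succ, extPerm_succ, adj_left, adj_right, ← D.G_symm _ _ hne] at this

theorem K_one_mul_P [NeZero k] (j : ℕ) (h : j + 1 < k) (hj : j ≠ 0) :
    D.K (Fin.succ 0) * D.P (adj j h) = D.P (adj j h) * D.K (Fin.succ 0) := by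
  rw [D.P_K, extPerm_succ, adj_of_ne] <;> simp [hj.symm]

end

variable {C A : Type*} [CommRing C] [Algebra ℂ C] [Ring A] [Algebra C A] {k : ℕ}
  (D : BraidData C A k)

/-- The image `½ K_j + ∑_{ℓ < j} G_{ℓ,j}` of `y_j`. -/
def Y (j : Fin k) : A :=
  algebraMap C A (algebraMap ℂ C (1 / 2)) * D.K j.succ +
    ∑ ℓ : Fin (k + 1) with ℓ < j.succ, D.G ℓ j.succ

theorem commute_K_Y (i : Fin (k + 1)) (j : Fin k) : Commute (D.K i) (D.Y j) := by
  refine Commute.add_right ?_ (Commute.sum_right _ _ _ fun ℓ hℓ => ?_)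
  · exact (Algebra.commute_algebraMap_right _ _).mul_right (D.K_comm _ _)
  · exact D.K_G _ _ _ (Finset.mem_filter.1 hℓ).2.ne

/-- The two terms of `Y j` that share an index with `G a i` commute with it only together. -/
theorem commute_G_Y {a i : Fin (k + 1)} {j : Fin k} (hai : a ≠ i) (ha : a < j.succ)
    (hi : i < j.succ) : Commute (D.G a i) (D.Y j) := by
  refine Commute.add_right ?_ ?_
  · exact (Algebra.commute_algebraMap_right _ _).mul_right (D.K_G _ _ _ hai).symm
  · rw [← Finset.add_sum_erase _ _ (Finset.mem_filter.2 ⟨Finset.mem_univ a, ha⟩),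
      ← Finset.add_sum_erase _ _ (Finset.mem_erase.2 ⟨hai.symm,
        Finset.mem_filter.2 ⟨Finset.mem_univ i, hi⟩⟩), ← add_assoc]
    refine (D.G_tri _ _ _ hai ha.ne hi.ne).add_right (Commute.sum_right _ _ _ fun ℓ hℓ => ?_)
    simp only [Finset.mem_erase, Finset.mem_filter, Finset.mem_univ, true_and] at hℓ
    exact D.G_disj _ _ _ _ hai hℓ.2.2.ne hℓ.2.1.symm ha.ne hℓ.1.symm hi.ne

theorem commute_Y_of_lt {i j : Fin k} (h : i < j) : Commute (D.Y i) (D.Y j) := by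
  have h' : i.succ < j.succ := Fin.succ_lt_succ_iff.2 h
  refine Commute.add_left ?_ (Commute.sum_left _ _ _ fun ℓ hℓ => ?_)
  · exact (Algebra.commute_algebraMap_left _ _).mul_left (D.commute_K_Y _ _)
  · have hℓ' := (Finset.mem_filter.1 hℓ).2
    exact D.commute_G_Y hℓ'.ne (hℓ'.trans h') h'

theorem commute_Y (i j : Fin k) : Commute (D.Y i) (D.Y j) := by
  rcases lt_trichotomy i j with h | rfl | h
  · exact D.commute_Y_of_lt h
  · exact Commute.refl _
  · exact (D.commute_Y_of_lt h).symm

theorem P_mul_Y (w : Equiv.Perm (Fin k)) (j : Fin k) :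
    D.P w * D.Y j = (algebraMap C A (algebraMap ℂ C (1 / 2)) * D.K (w j).succ +
      ∑ ℓ : Fin (k + 1) with ℓ < j.succ, D.G (extPerm w ℓ) (w j).succ) * D.P w := by
  rw [Y, mul_add, add_mul, Finset.mul_sum, Finset.sum_mul, ← mul_assoc, ← Algebra.commutes,
    mul_assoc, D.P_K, ← mul_assoc]
  congr 1
  exact Finset.sum_congr rfl fun ℓ hℓ => D.P_G _ _ _ (Finset.mem_filter.1 hℓ).2.ne

/-- This is the identity `y_{i+1} - t_{s_i} y_i t_{s_i} = γ_{i,i+1}`. -/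
theorem P_adj_mul_Y (i : ℕ) (h : i + 1 < k) :
    D.P (adj i h) * D.Y ⟨i, by omega⟩ =
      (D.Y ⟨i + 1, h⟩ - D.G (Fin.succ ⟨i, by omega⟩) (Fin.succ ⟨i + 1, h⟩)) * D.P (adj i h) := by
  rw [D.P_mul_Y]
  congr 1
  rw [Y, sum_filter_lt_succ, adj_left, add_sub_assoc, add_sub_cancel_left]
  congr 1
  refine Finset.sum_congr rfl fun ℓ hℓ => ?_
  rw [extPerm_adj_of_lt i h]
  simpa [Fin.lt_def] using hℓ

theorem P_adj_mul_Y_add (i : ℕ) (h : i + 1 < k) :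
    D.P (adj i h) * (D.Y ⟨i, by omega⟩ + D.Y ⟨i + 1, h⟩) =
      (D.Y ⟨i, by omega⟩ + D.Y ⟨i + 1, h⟩) * D.P (adj i h) := by
  set s := D.P (adj i h) with hs
  have hss : s * s = 1 := D.P_adj_mul_self i h
  have h1 := D.P_adj_mul_Y i h
  rw [← hs] at h1
  have h2 := congrArg (fun x => s * x * s) h1
  simp only [← mul_assoc, hss, one_mul] at h2
  rw [mul_assoc _ s s, hss, mul_one, mul_sub] at h2
  have h3 : s * _ = _ * s := D.commute_P_G i h
  rw [mul_add, h1, add_mul, h2, sub_mul, ← h3]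
  abel

theorem P_adj_commute_Y (i : ℕ) (h : i + 1 < k) (j : Fin k) (h₁ : (j : ℕ) ≠ i)
    (h₂ : (j : ℕ) ≠ i + 1) : D.P (adj i h) * D.Y j = D.Y j * D.P (adj i h) := by
  rw [D.P_mul_Y, adj_of_ne i h h₁ h₂, Y]
  congr 2
  refine Finset.sum_equiv (extPerm (adj i h)) (fun ℓ => ?_) fun _ _ => rfl
  simp only [Finset.mem_filter, Finset.mem_univ, true_and]
  cases ℓ using Fin.cases with
  | zero => simp
  | succ ℓ =>
    rw [extPerm_succ, Fin.succ_lt_succ_iff, Fin.succ_lt_succ_iff, adj, Equiv.swap_apply_def]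
    split_ifs with h3 h4 <;> simp only [Fin.lt_def, Fin.ext_iff] at * <;> omega

variable [NeZero k]

/-- The values of the representation on the generators of `𝓑_k`. -/
def gen : Gen k → A
  | .t u => D.P u
  | .κ₀ => D.K 0
  | .κ₁ => D.K (Fin.succ 0)
  | .y j => D.Y j

theorem lift_fGamma (i : ℕ) (h : i + 1 < k) :
    FreeAlgebra.lift C D.gen (fGamma C i h) =
      D.G (Fin.succ ⟨i, by omega⟩) (Fin.succ ⟨i + 1, h⟩) := by
  simp only [fGamma, fT, fY, map_sub, map_mul, FreeAlgebra.lift_ι_apply, gen]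
  rw [D.P_adj_mul_Y, mul_assoc, D.P_adj_mul_self, mul_one, sub_sub_cancel]

theorem lift_rel {x y : FreeAlgebra C (Gen k)} (h : BraidRel C x y) :
    FreeAlgebra.lift C D.gen x = FreeAlgebra.lift C D.gen y := by
  cases h with
  | γ_shift i h =>
    simp only [map_mul, lift_fGamma]
    simp only [fT, FreeAlgebra.lift_ι_apply, gen]
    have e : ∀ a b g : A, a * b * g * b * a = (a * b) * g * (b * a) := fun a b g => by
      simp only [mul_assoc]
    rw [e, ← map_mul, ← map_mul]
    have hi : adj (i + 1) h * adj i (by omega) = (adj i (by omega) * adj (i + 1) h)⁻¹ := by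
      rw [mul_inv_rev, adj_inv, adj_inv]
    rw [hi, D.conj_G _ (by simp [Fin.ext_iff])]
    simp only [extPerm_succ, Equiv.Perm.mul_apply]
    rw [adj_left, adj_of_ne (j := ⟨i, _⟩), adj_left, adj_of_ne] <;> simp <;> omega
  | κ₁_t_first h =>
    simp only [map_mul, fT, fK1, FreeAlgebra.lift_ι_apply, gen]
    have h1 := D.conj_K (adj 0 h) (Fin.succ 0)
    rw [adj_inv] at h1
    rw [h1, ← (D.K_comm _ _).eq, ← h1]
    simp only [mul_assoc]
  | κ₀_t i h =>
    simp only [map_mul, fT, fK0, FreeAlgebra.lift_ι_apply, gen]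
    rw [D.P_K, extPerm_zero]
  | t_one => simp [fT, gen]
  | t_mul u v => simp [fT, gen]
  | _ =>
    simp only [map_mul, map_add, fT, fY, fK0, fK1, FreeAlgebra.lift_ι_apply, gen]
    first
    | exact D.commute_Y _ _
    | exact D.K_comm _ _
    | exact D.commute_K_Y _ _
    | exact D.P_adj_mul_Y_add _ _
    | exact (D.P_adj_commute_Y _ _ _ ‹_› ‹_›).symm
    | exact D.K_one_mul_P _ _ ‹_›

/-- The representation of `𝓑_k` given by `D`. -/
def toHom : Braid C k →ₐ[C] A :=
  RingQuot.liftAlgHom C ⟨FreeAlgebra.lift C D.gen, fun _ _ h => D.lift_rel h⟩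

@[simp] theorem toHom_t (w : Equiv.Perm (Fin k)) : D.toHom (Braid.t C w) = D.P w := by
  simp [toHom, Braid.t, fT, gen]

@[simp] theorem toHom_κ₀ : D.toHom (Braid.κ₀ C) = D.K 0 := by
  simp [toHom, Braid.κ₀, fK0, gen]

@[simp] theorem toHom_κ₁ : D.toHom (Braid.κ₁ C) = D.K (Fin.succ 0) := by
  simp [toHom, Braid.κ₁, fK1, gen]

@[simp] theorem toHom_y (j : Fin k) : D.toHom (Braid.y C j) = D.Y j := by
  simp [toHom, Braid.y, fY, gen]

@[simp] theorem toHom_κ (j : Fin (k + 1)) : D.toHom (Braid.κ C j) = D.K j := by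
  cases j using Fin.cases with
  | zero => simp [Braid.κ]
  | succ j =>
    have := D.conj_K (Equiv.swap 0 j) (Fin.succ 0)
    rw [Equiv.swap_inv, extPerm_succ, Equiv.swap_apply_left] at this
    simp only [Braid.κ, Fin.cases_succ, map_mul, toHom_t, toHom_κ₁, this]

theorem toHom_γ₀₁ : D.toHom (Braid.γ₀₁ C) = D.G 0 (Fin.succ 0) := by
  have : (Finset.univ.filter fun ℓ : Fin (k + 1) => ℓ < Fin.succ 0) = {0} := by
    ext ℓ
    rw [Finset.mem_filter, Finset.mem_singleton, Fin.lt_def, Fin.ext_iff, Fin.val_succ,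
      Fin.val_zero, Fin.val_zero]
    simp
  simp only [Braid.γ₀₁, map_sub, map_mul, AlgHom.commutes, toHom_y, toHom_κ₁, Y, this,
    Finset.sum_singleton, add_sub_cancel_left]

theorem toHom_γ₁₂ (h : 0 + 1 < k) :
    D.toHom (Braid.γ₁₂ C) = D.G (Fin.succ 0) (Fin.succ 1) := by
  have h1 : (1 : Fin k) = ⟨0 + 1, h⟩ := by
    ext; simpa using Nat.mod_eq_of_lt h
  have h0 : (0 : Fin k) = ⟨0, by omega⟩ := rfl
  have := D.P_adj_mul_Y 0 h
  simp only [Braid.γ₁₂, map_sub, map_mul, toHom_t, toHom_y, h1, h0]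
  change _ - D.P (adj 0 h) * _ * D.P (adj 0 h) = _
  rw [this, mul_assoc, D.P_adj_mul_self, mul_one, sub_sub_cancel]

@[simp] theorem toHom_γ {ℓ m : Fin (k + 1)} (hne : ℓ ≠ m) :
    D.toHom (Braid.γ C ℓ m) = D.G ℓ m := by
  have h0 (j : Fin k) : D.toHom (Braid.t C (Equiv.swap 0 j) * Braid.γ₀₁ C *
      Braid.t C (Equiv.swap 0 j)⁻¹) = D.G 0 j.succ := by
    rw [map_mul, map_mul, toHom_γ₀₁, toHom_t, toHom_t, D.conj_G _ (by simp),
      extPerm_zero, extPerm_succ, Equiv.swap_apply_left]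
  cases ℓ using Fin.cases with
  | zero =>
    cases m using Fin.cases with
    | zero => exact absurd rfl hne
    | succ j => exact h0 j
  | succ i =>
    cases m using Fin.cases with
    | zero => exact (h0 i).trans (D.G_symm _ _ hne.symm)
    | succ j =>
      -- Two distinct positions exist, so `0` and `1` are distinct in `Fin k`.
      have hij : i ≠ j := fun h => hne (by rw [h])
      have hk : 0 + 1 < k := by
        have := i.2; have := j.2
        have : (i : ℕ) ≠ j := fun h => hij (Fin.ext h)
        omega
      have h01 : (0 : Fin k) ≠ 1 := by
        have : ((1 : Fin k) : ℕ) = 1 := by simpa using Nat.mod_eq_of_lt hk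
        intro h; rw [← h] at this; simp at this
      have hs : Equiv.swap 0 i j ≠ 0 := fun h => hij (by
        rw [Equiv.swap_apply_eq_iff, Equiv.swap_apply_left] at h
        exact h.symm)
      simp only [Braid.γ, Fin.cases_succ]
      rw [map_mul, map_mul, D.toHom_γ₁₂ hk, toHom_t, toHom_t,
        D.conj_G _ ((Fin.succ_injective k).ne h01), extPerm_succ, extPerm_succ]
      simp only [Braid.moveTo, Equiv.Perm.mul_apply]
      rw [Equiv.swap_apply_of_ne_of_ne h01 hs.symm, Equiv.swap_apply_left, Equiv.swap_apply_left,
        Equiv.swap_apply_self]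

theorem toHom_e (i : ℕ) (h : i + 1 < k) : D.toHom (Braid.e C i h) =
    1 - D.G (Fin.succ ⟨i, by omega⟩) (Fin.succ ⟨i + 1, h⟩) * D.P (adj i h) := by
  simp only [Braid.e, map_add, map_sub, map_mul, map_one, toHom_t, toHom_y]
  rw [D.P_adj_mul_Y, sub_mul]
  abel

end BraidData

/-! ### Operators on the tensor factors -/

section Slots

variable {M : Type*} [AddCommGroup M] [Module ℂ M] {V : Type*} [AddCommGroup V] [Module ℂ V] {k : ℕ}

theorem TSpace.hom_ext {f g : Module.End ℂ (TSpace M V k)}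
    (h : ∀ m v, f (m ⊗ₜ PiTensorProduct.tprod ℂ v) = g (m ⊗ₜ PiTensorProduct.tprod ℂ v)) :
    f = g := by
  refine TensorProduct.ext' fun m x => ?_
  induction x using PiTensorProduct.induction_on with
  | smul_tprod c v => rw [TensorProduct.tmul_smul, map_smul, map_smul, h]
  | add x y hx hy => rw [TensorProduct.tmul_add, map_add, map_add, hx, hy]

/-- `mul_neg` in a form usable for rewriting: the instances behind the negation and the product of
operators on `M ⊗ V^{⊗ k}` agree only after unfolding. -/
theorem TSpace.end_mul_neg (f g : Module.End ℂ (TSpace M V k)) : f * -g = -(f * g) :=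
  mul_neg f g

/-- `neg_mul` in a form usable for rewriting. -/
theorem TSpace.end_neg_mul (f g : Module.End ℂ (TSpace M V k)) : -f * g = -(f * g) :=
  neg_mul f g

variable (M V) in
/-- An endomorphism of `V` acting in the `j`-th factor `V` of `M ⊗ V^{⊗ k}`. -/
def factor (j : Fin k) : Module.End ℂ V →ₐ[ℂ] Module.End ℂ (TSpace M V k) :=
  AlgHom.ofLinearMap (LinearMap.lTensorHom M ∘ₗ
      (PiTensorProduct.mapMultilinear ℂ (fun _ : Fin k => V) (fun _ => V)).toLinearMap
        (fun _ => LinearMap.id) j)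
    (TSpace.hom_ext fun m v => by
      simp only [LinearMap.coe_comp, Function.comp_apply, MultilinearMap.toLinearMap_apply,
        PiTensorProduct.mapMultilinear_apply, LinearMap.coe_lTensorHom, LinearMap.lTensor_tmul,
        PiTensorProduct.map_tprod, Module.End.one_apply]
      congr 2
      ext i
      by_cases hi : i = j
      · subst hi; simp
      · simp [hi])
    (fun x y => TSpace.hom_ext fun m v => by
      simp only [LinearMap.coe_comp, Function.comp_apply, MultilinearMap.toLinearMap_apply,
        PiTensorProduct.mapMultilinear_apply, LinearMap.coe_lTensorHom, LinearMap.lTensor_tmul,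
        PiTensorProduct.map_tprod, Module.End.mul_apply]
      congr 2
      ext i
      by_cases hi : i = j
      · subst hi; simp
      · simp [hi])

@[simp] theorem factor_tmul (j : Fin k) (x : Module.End ℂ V) (m : M) (v : Fin k → V) :
    factor M V j x (m ⊗ₜ PiTensorProduct.tprod ℂ v) =
      m ⊗ₜ PiTensorProduct.tprod ℂ (Function.update v j (x (v j))) := by
  simp only [factor, AlgHom.ofLinearMap_apply, LinearMap.coe_comp, Function.comp_apply,
    MultilinearMap.toLinearMap_apply, PiTensorProduct.mapMultilinear_apply,
    LinearMap.coe_lTensorHom, LinearMap.lTensor_tmul, PiTensorProduct.map_tprod]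
  congr 2
  ext i
  by_cases hi : i = j
  · subst hi; simp
  · simp [hi]

theorem factor_one (j : Fin k) : factor M V j 1 = 1 := map_one _

theorem factor_commute {i j : Fin k} (h : i ≠ j) (x y : Module.End ℂ V) :
    Commute (factor M V i x) (factor M V j y) :=
  TSpace.hom_ext fun m v => by
    simp only [Module.End.mul_apply, factor_tmul]
    rw [Function.update_comm h.symm, Function.update_of_ne h, Function.update_of_ne h.symm]

@[simp] theorem permOp_tmul (w : Equiv.Perm (Fin k)) (m : M) (v : Fin k → V) :
    permOp M V w (m ⊗ₜ PiTensorProduct.tprod ℂ v) =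
      m ⊗ₜ PiTensorProduct.tprod ℂ fun i => v (w.symm i) := by
  rw [permOp, LinearMap.lTensor_tmul]
  exact congrArg _ (PiTensorProduct.reindex_tprod w v)

variable (M V) in
/-- The permutation action of `S_k` on `M ⊗ V^{⊗ k}`. -/
def permHom (k : ℕ) : Equiv.Perm (Fin k) →* Module.End ℂ (TSpace M V k) where
  toFun := permOp M V
  map_one' := TSpace.hom_ext fun m v => by rw [permOp_tmul]; rfl
  map_mul' := fun u w => TSpace.hom_ext fun m v => by
    rw [Module.End.mul_apply]
    simp only [permOp_tmul]
    rfl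

@[simp] theorem permHom_apply (w : Equiv.Perm (Fin k)) : permHom M V k w = permOp M V w := rfl

theorem permOp_mul_factor (w : Equiv.Perm (Fin k)) (j : Fin k) (x : Module.End ℂ V) :
    permOp M V w * factor M V j x = factor M V (w j) x * permOp M V w :=
  TSpace.hom_ext fun m v => by
    simp only [Module.End.mul_apply, factor_tmul, permOp_tmul, Equiv.symm_apply_apply]
    congr 2
    ext i
    by_cases hi : i = w j
    · subst hi; simp
    · rw [Function.update_of_ne hi, Function.update_of_ne (fun h => hi (by rw [← h]; simp))]

/-- An element of `End(V) ⊗ End(V)` acting in the `i`-th and `j`-th factors `V`. -/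
def factor₂ (M V : Type*) [AddCommGroup M] [Module ℂ M] [AddCommGroup V] [Module ℂ V]
    {i j : Fin k} (h : i ≠ j) :
    Module.End ℂ V ⊗[ℂ] Module.End ℂ V →ₐ[ℂ] Module.End ℂ (TSpace M V k) :=
  Algebra.TensorProduct.lift (factor M V i) (factor M V j) fun x y => factor_commute h x y

@[simp] theorem factor₂_tmul {i j : Fin k} (h : i ≠ j) (x y : Module.End ℂ V) :
    factor₂ M V h (x ⊗ₜ y) = factor M V i x * factor M V j y :=
  Algebra.TensorProduct.lift_tmul _ _ _ _ _

end Slots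

section SlotsU

variable {𝔤 : Type*} [LieRing 𝔤] [LieAlgebra ℂ 𝔤]
variable {M : Type*} [AddCommGroup M] [Module ℂ M] [LieRingModule 𝔤 M] [LieModule ℂ 𝔤 M]
variable {V : Type*} [AddCommGroup V] [Module ℂ V] [LieRingModule 𝔤 V] [LieModule ℂ 𝔤 V]
variable {k : ℕ}

theorem slot_zero_tmul (u : U 𝔤) (m : M) (v : ⨂[ℂ] _ : Fin k, V) :
    slot 𝔤 M V 0 u (m ⊗ₜ v) = rep 𝔤 M u m ⊗ₜ v := rfl

theorem slot_succ (j : Fin k) (u : U 𝔤) :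
    slot 𝔤 M V j.succ u = factor M V j (rep 𝔤 V u) := rfl

theorem slot_one (ℓ : Fin (k + 1)) : slot 𝔤 M V ℓ 1 = 1 := by
  cases ℓ using Fin.cases with
  | zero => exact TSpace.hom_ext fun m v => by rw [slot_zero_tmul, map_one]; rfl
  | succ j => rw [slot_succ, map_one, map_one]

theorem slot_mul (ℓ : Fin (k + 1)) (u v : U 𝔤) :
    slot 𝔤 M V ℓ (u * v) = slot 𝔤 M V ℓ u * slot 𝔤 M V ℓ v := by
  cases ℓ using Fin.cases with
  | zero =>
    exact TSpace.hom_ext fun m v => by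
      rw [Module.End.mul_apply, slot_zero_tmul, slot_zero_tmul, slot_zero_tmul, map_mul]; rfl
  | succ j => rw [slot_succ, map_mul, map_mul]; rfl

variable (𝔤 M V) in
/-- The map `slot` as a homomorphism of algebras. -/
def slotHom (ℓ : Fin (k + 1)) : U 𝔤 →ₐ[ℂ] Module.End ℂ (TSpace M V k) :=
  AlgHom.ofLinearMap (slot 𝔤 M V ℓ) (slot_one ℓ) (slot_mul ℓ)

theorem slot_zero_commute_factor (u : U 𝔤) (j : Fin k) (x : Module.End ℂ V) :
    Commute (slot 𝔤 M V 0 u) (factor M V j x) :=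
  TSpace.hom_ext fun m v => by
    simp only [Module.End.mul_apply, factor_tmul, slot_zero_tmul]

theorem slot_commute {ℓ m : Fin (k + 1)} (h : ℓ ≠ m) (u v : U 𝔤) :
    Commute (slot 𝔤 M V ℓ u) (slot 𝔤 M V m v) := by
  cases ℓ using Fin.cases with
  | zero =>
    cases m using Fin.cases with
    | zero => exact absurd rfl h
    | succ j => exact slot_zero_commute_factor _ _ _
  | succ i =>
    cases m using Fin.cases with
    | zero =>
      rw [slot_succ]
      exact (slot_zero_commute_factor v i _).symm
    | succ j =>
      rw [slot_succ, slot_succ]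
      exact factor_commute (fun h' : i = j => h (congrArg Fin.succ h')) _ _

theorem permOp_mul_slot (w : Equiv.Perm (Fin k)) (ℓ : Fin (k + 1)) (u : U 𝔤) :
    permOp M V w * slot 𝔤 M V ℓ u = slot 𝔤 M V (extPerm w ℓ) u * permOp M V w := by
  cases ℓ using Fin.cases with
  | zero =>
    rw [extPerm_zero]
    refine TSpace.hom_ext fun m v => ?_
    rw [Module.End.mul_apply, Module.End.mul_apply, permOp_tmul, slot_zero_tmul, slot_zero_tmul,
      permOp_tmul]
  | succ j => exact permOp_mul_factor _ _ _

@[simp] theorem slot₂_tmul (ℓ m : Fin (k + 1)) (u v : U 𝔤) :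
    slot₂ 𝔤 M V ℓ m (u ⊗ₜ v) = slot 𝔤 M V ℓ u * slot 𝔤 M V m v := rfl

variable (𝔤 M V) in
/-- The algebra `U𝔤 ⊗ End(V)` acting on `M` and on the `j`-th factor `V`. -/
def slotFactor (j : Fin k) : U 𝔤 ⊗[ℂ] Module.End ℂ V →ₐ[ℂ] Module.End ℂ (TSpace M V k) :=
  Algebra.TensorProduct.lift (slotHom 𝔤 M V 0) (factor M V j)
    fun u x => slot_zero_commute_factor u j x

theorem slotFactor_tmul (j : Fin k) (u : U 𝔤) (x : Module.End ℂ V) :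
    slotFactor 𝔤 M V j (u ⊗ₜ[ℂ] x) = slot 𝔤 M V 0 u * factor M V j x :=
  Algebra.TensorProduct.lift_tmul _ _ _ _ _

theorem slotFactor_one (j : Fin k) : slotFactor 𝔤 M V j 1 = 1 := by
  rw [Algebra.TensorProduct.one_def, slotFactor_tmul, slot_one, factor_one, one_mul]

theorem slotFactor_pow (j : Fin k) (T : U 𝔤 ⊗[ℂ] Module.End ℂ V) (n : ℕ) :
    slotFactor 𝔤 M V j (T ^ n) = slotFactor 𝔤 M V j T ^ n := by
  induction n with
  | zero => rw [pow_zero, pow_zero, slotFactor_one]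
  | succ n ih => rw [pow_succ, pow_succ, map_mul, ih]

end SlotsU

/-! ### The Casimir element and its polarization -/

section Casimir

variable {𝔤 : Type*} [LieRing 𝔤] [LieAlgebra ℂ 𝔤]

local notation "ι" => UniversalEnvelopingAlgebra.ι ℂ

/-- `U𝔤` is generated by `𝔤`. -/
theorem mem_subalgebra_of_ι_mem (S : Subalgebra ℂ (U 𝔤)) (h : ∀ x : 𝔤, ι x ∈ S) (u : U 𝔤) :
    u ∈ S := by
  let f : 𝔤 →ₗ⁅ℂ⁆ S :=
    { (ι : 𝔤 →ₗ⁅ℂ⁆ U 𝔤).toLinearMap.codRestrict (Subalgebra.toSubmodule S) h with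
      map_lie' := fun {x y} => Subtype.ext ((ι : 𝔤 →ₗ⁅ℂ⁆ U 𝔤).map_lie x y) }
  have : S.val.comp (UniversalEnvelopingAlgebra.lift ℂ f) = AlgHom.id ℂ (U 𝔤) := by
    apply UniversalEnvelopingAlgebra.hom_ext
    ext x
    change ((UniversalEnvelopingAlgebra.lift ℂ f (ι x) : S) : U 𝔤) = ι x
    rw [UniversalEnvelopingAlgebra.lift_ι_apply]
    rfl
  have h' := DFunLike.congr_fun this u
  rw [AlgHom.id_apply] at h'
  rw [← h']
  exact (UniversalEnvelopingAlgebra.lift ℂ f u).2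

theorem mem_center_of_commute_ι {u : U 𝔤} (h : ∀ x : 𝔤, Commute (ι x) u) :
    u ∈ Subalgebra.center ℂ (U 𝔤) := by
  rw [Subalgebra.mem_center_iff]
  intro v
  have := mem_subalgebra_of_ι_mem (Subalgebra.centralizer ℂ {u})
    (fun x => by
      rw [Subalgebra.mem_centralizer_iff]
      rintro _ rfl
      exact (h x).symm) v
  exact ((Subalgebra.mem_centralizer_iff ℂ).1 this u rfl).symm

variable [FiniteDimensional ℂ 𝔤] (F : LinearMap.BilinForm ℂ 𝔤) (hF : F.Nondegenerate)

local notation "bas" => Module.finBasis ℂ 𝔤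

local notation "dua" => LinearMap.BilinForm.dualBasis F hF (Module.finBasis ℂ 𝔤)

variable {F} (hs : F.IsSymm) (hi : ∀ x y z, F ⁅x, y⁆ z = F x ⁅y, z⁆)

theorem sum_form_smul_dual (x : 𝔤) : ∑ i, F x (bas i) • dua i = x := by
  conv_rhs => rw [← (dua).sum_repr x]
  simp only [LinearMap.BilinForm.dualBasis_repr_apply]

include hs in
theorem sum_form_dual_smul (x : 𝔤) : ∑ i, F x (dua i) • bas i = x := by
  conv_rhs => rw [← (bas).sum_repr x]
  refine Finset.sum_congr rfl fun i _ => ?_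
  congr 1
  have h := LinearMap.BilinForm.dualBasis_repr_apply hF (dua) x i
  rw [LinearMap.BilinForm.dualBasis_dualBasis hF hs] at h
  exact h.symm

variable {W : Type*} [AddCommGroup W] [Module ℂ W] (f : 𝔤 →ₗ[ℂ] 𝔤 →ₗ[ℂ] W)

include hs in
/-- The tensor `∑ b ⊗ b^*` is symmetric. -/
theorem sum_basis_dual_symm : ∑ i, f (bas i) (dua i) = ∑ i, f (dua i) (bas i) := by
  have h (i) : bas i = ∑ j, F (bas i) (bas j) • dua j := (sum_form_smul_dual hF _).symm
  calc ∑ i, f (bas i) (dua i)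
      = ∑ i, ∑ j, F (bas i) (bas j) • f (dua j) (dua i) := by
        refine Finset.sum_congr rfl fun i _ => ?_
        conv_lhs => rw [h i]
        simp
    _ = ∑ i, ∑ j, F (bas i) (bas j) • f (dua i) (dua j) := by
        rw [Finset.sum_comm]
        refine Finset.sum_congr rfl fun i _ => Finset.sum_congr rfl fun j _ => ?_
        rw [hs.eq]
    _ = ∑ i, f (dua i) (bas i) := by
        refine Finset.sum_congr rfl fun i _ => ?_
        conv_rhs => rw [h i]
        simp

include hs hi in
/-- The tensor `∑ b ⊗ b^*` is invariant. -/
theorem sum_basis_dual_invariant (x : 𝔤) :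
    ∑ i, (f ⁅x, bas i⁆ (dua i) + f (bas i) ⁅x, dua i⁆) = 0 := by
  have h1 (i) : f ⁅x, bas i⁆ (dua i) = ∑ j, F ⁅x, bas i⁆ (dua j) • f (bas j) (dua i) := by
    conv_lhs => rw [← sum_form_dual_smul hF hs ⁅x, bas i⁆]
    simp
  have h2 (i) : f (bas i) ⁅x, dua i⁆ = ∑ j, F ⁅x, dua i⁆ (bas j) • f (bas i) (dua j) := by
    conv_lhs => rw [← sum_form_smul_dual hF ⁅x, dua i⁆]
    simp
  rw [Finset.sum_add_distrib]
  simp only [h1, h2]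
  rw [Finset.sum_comm, ← Finset.sum_add_distrib]
  refine Finset.sum_eq_zero fun i _ => ?_
  rw [← Finset.sum_add_distrib]
  refine Finset.sum_eq_zero fun j _ => ?_
  rw [← add_smul, hi, hi, ← lie_skew, map_neg, neg_add_cancel, zero_smul]

include hs hi in
theorem casimir_mem_center : casimir F hF ∈ Subalgebra.center ℂ (U 𝔤) := by
  refine mem_center_of_commute_ι fun x => ?_
  have := sum_basis_dual_invariant hF hs hi
    ((LinearMap.mul ℂ (U 𝔤)).compl₁₂ (ι : 𝔤 →ₗ⁅ℂ⁆ U 𝔤).toLinearMap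
      (ι : 𝔤 →ₗ⁅ℂ⁆ U 𝔤).toLinearMap) x
  simp only [LinearMap.compl₁₂_apply, LinearMap.mul_apply', LieHom.coe_toLinearMap,
    LieHom.map_lie, LieRing.of_associative_ring_bracket] at this
  rw [commute_iff_eq, ← sub_eq_zero, casimir, Finset.mul_sum, Finset.sum_mul,
    ← Finset.sum_sub_distrib, ← this]
  refine Finset.sum_congr rfl fun i _ => ?_
  noncomm_ring

end Casimir

section Gamma

variable {𝔤 : Type*} [LieRing 𝔤] [LieAlgebra ℂ 𝔤]
variable {M : Type*} [AddCommGroup M] [Module ℂ M] [LieRingModule 𝔤 M] [LieModule ℂ 𝔤 M]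
variable {V : Type*} [AddCommGroup V] [Module ℂ V] [LieRingModule 𝔤 V] [LieModule ℂ 𝔤 V]
variable {k : ℕ}

local notation "ι" => UniversalEnvelopingAlgebra.ι ℂ

theorem slot_commute_of_mem_center {u : U 𝔤} (hu : u ∈ Subalgebra.center ℂ (U 𝔤))
    (ℓ m : Fin (k + 1)) (v : U 𝔤) : Commute (slot 𝔤 M V ℓ u) (slot 𝔤 M V m v) := by
  by_cases h : ℓ = m
  · subst h
    rw [commute_iff_eq, ← slot_mul, ← slot_mul, (Subalgebra.mem_center_iff.1 hu v)]
  · exact slot_commute h u v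

theorem commute_slot₂_of_commute {ℓ m : Fin (k + 1)} {x : Module.End ℂ (TSpace M V k)}
    (h₁ : ∀ u, Commute x (slot 𝔤 M V ℓ u)) (h₂ : ∀ u, Commute x (slot 𝔤 M V m u))
    (g : U 𝔤 ⊗[ℂ] U 𝔤) : Commute x (slot₂ 𝔤 M V ℓ m g) := by
  induction g using TensorProduct.induction_on with
  | zero => rw [map_zero]; exact Commute.zero_right _
  | tmul u v => rw [slot₂_tmul]; exact (h₁ u).mul_right (h₂ v)
  | add a b ha hb => rw [map_add]; exact ha.add_right hb

theorem permOp_mul_slot₂ (w : Equiv.Perm (Fin k)) (ℓ m : Fin (k + 1)) (g : U 𝔤 ⊗[ℂ] U 𝔤) :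
    permOp M V w * slot₂ 𝔤 M V ℓ m g =
      slot₂ 𝔤 M V (extPerm w ℓ) (extPerm w m) g * permOp M V w := by
  induction g using TensorProduct.induction_on with
  | zero => rw [map_zero, map_zero, mul_zero, zero_mul]
  | tmul u v =>
    rw [slot₂_tmul, slot₂_tmul, ← mul_assoc, permOp_mul_slot, mul_assoc, permOp_mul_slot, mul_assoc]
  | add a b ha hb => rw [map_add, map_add, mul_add, add_mul, ha, hb]

/-- The bilinear map `(x, y) ↦ x y` with `x` acting in the `ℓ`-th and `y` in the `m`-th factor. -/
def slotBilin (𝔤 : Type*) [LieRing 𝔤] [LieAlgebra ℂ 𝔤]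
    (M : Type*) [AddCommGroup M] [Module ℂ M] [LieRingModule 𝔤 M] [LieModule ℂ 𝔤 M]
    (V : Type*) [AddCommGroup V] [Module ℂ V] [LieRingModule 𝔤 V] [LieModule ℂ 𝔤 V]
    {k : ℕ} (ℓ m : Fin (k + 1)) :
    𝔤 →ₗ[ℂ] 𝔤 →ₗ[ℂ] Module.End ℂ (TSpace M V k) :=
  (LinearMap.mul ℂ (Module.End ℂ (TSpace M V k))).compl₁₂
    (slot 𝔤 M V ℓ ∘ₗ (ι : 𝔤 →ₗ⁅ℂ⁆ U 𝔤).toLinearMap)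
    (slot 𝔤 M V m ∘ₗ (ι : 𝔤 →ₗ⁅ℂ⁆ U 𝔤).toLinearMap)

@[simp] theorem slotBilin_apply (ℓ m : Fin (k + 1)) (x y : 𝔤) :
    slotBilin 𝔤 M V ℓ m x y = slot 𝔤 M V ℓ (ι x) * slot 𝔤 M V m (ι y) := rfl

theorem slot_lie (ℓ : Fin (k + 1)) (x y : 𝔤) : slot 𝔤 M V ℓ (ι ⁅x, y⁆) =
    slot 𝔤 M V ℓ (ι x) * slot 𝔤 M V ℓ (ι y) - slot 𝔤 M V ℓ (ι y) * slot 𝔤 M V ℓ (ι x) := by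
  rw [LieHom.map_lie, LieRing.of_associative_ring_bracket, map_sub, slot_mul, slot_mul]

variable [FiniteDimensional ℂ 𝔤]

variable {F : LinearMap.BilinForm ℂ 𝔤} (hF : F.Nondegenerate)

variable (M V) in
theorem slot₂_gammaElt (ℓ m : Fin (k + 1)) : slot₂ 𝔤 M V ℓ m (gammaElt F hF) =
    ∑ i, slot 𝔤 M V ℓ (ι (Module.finBasis ℂ 𝔤 i)) *
      slot 𝔤 M V m (ι (F.dualBasis hF (Module.finBasis ℂ 𝔤) i)) := by
  simp only [gammaElt, map_sum, slot₂_tmul]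

variable (M V) in
theorem slot_casimir (ℓ : Fin (k + 1)) : slot 𝔤 M V ℓ (casimir F hF) =
    ∑ i, slot 𝔤 M V ℓ (ι (Module.finBasis ℂ 𝔤 i)) *
      slot 𝔤 M V ℓ (ι (F.dualBasis hF (Module.finBasis ℂ 𝔤) i)) := by
  simp only [casimir, map_sum, slot_mul]

variable (hs : F.IsSymm) (hi : ∀ x y z, F ⁅x, y⁆ z = F x ⁅y, z⁆)

include hs in
theorem slot₂_gammaElt_symm {ℓ m : Fin (k + 1)} (h : ℓ ≠ m) :
    slot₂ 𝔤 M V ℓ m (gammaElt F hF) = slot₂ 𝔤 M V m ℓ (gammaElt F hF) := by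
  rw [slot₂_gammaElt, slot₂_gammaElt]
  refine (sum_basis_dual_symm hF hs (slotBilin 𝔤 M V ℓ m)).trans ?_
  exact Finset.sum_congr rfl fun i _ => (slot_commute h _ _).eq

include hs hi in
theorem commute_slot₂_gammaElt_add {ℓ m : Fin (k + 1)} (h : ℓ ≠ m) (x : 𝔤) :
    Commute (slot 𝔤 M V ℓ (ι x) + slot 𝔤 M V m (ι x)) (slot₂ 𝔤 M V ℓ m (gammaElt F hF)) := by
  have h1 := sum_basis_dual_invariant hF hs hi (slotBilin 𝔤 M V ℓ m) x
  rw [commute_iff_eq, ← sub_eq_zero, slot₂_gammaElt, Finset.mul_sum, Finset.sum_mul,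
    ← Finset.sum_sub_distrib, ← h1]
  refine Finset.sum_congr rfl fun i _ => ?_
  have h2 := (slot_commute (M := M) (V := V) h (ι (Module.finBasis ℂ 𝔤 i)) (ι x)).eq
  have h3 := (slot_commute (M := M) (V := V) h (ι x)
    (ι (F.dualBasis hF (Module.finBasis ℂ 𝔤) i))).eq
  rw [slotBilin_apply, slotBilin_apply, slot_lie, slot_lie, sub_mul, mul_sub, add_mul, mul_add,
    ← mul_assoc (slot 𝔤 M V m (ι x)), ← h2, mul_assoc _ _ (slot 𝔤 M V ℓ (ι x)), ← h3]
  noncomm_ring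

include hs hi in
/-- The infinitesimal braid relation. -/
theorem commute_slot₂_gammaElt_slot₂_add {ℓ m n : Fin (k + 1)} (h₁ : ℓ ≠ m) (h₂ : ℓ ≠ n)
    (h₃ : m ≠ n) : Commute (slot₂ 𝔤 M V ℓ m (gammaElt F hF))
      (slot₂ 𝔤 M V ℓ n (gammaElt F hF) + slot₂ 𝔤 M V m n (gammaElt F hF)) := by
  rw [slot₂_gammaElt M V hF ℓ n, slot₂_gammaElt M V hF m n, ← Finset.sum_add_distrib]
  refine Commute.sum_right _ _ _ fun i _ => ?_
  rw [← add_mul]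
  refine (commute_slot₂_gammaElt_add hF hs hi h₁ _).symm.mul_right ?_
  exact (commute_slot₂_of_commute (fun u => slot_commute h₂.symm _ _)
    (fun u => slot_commute h₃.symm _ _) _).symm

end Gamma

/-! ### The representation on `M ⊗ V^{⊗ k}` -/

section TensorRep

variable (𝔤 : Type*) [LieRing 𝔤] [LieAlgebra ℂ 𝔤]
variable (M : Type*) [AddCommGroup M] [Module ℂ M] [LieRingModule 𝔤 M] [LieModule ℂ 𝔤 M]
variable (V : Type*) [AddCommGroup V] [Module ℂ V] [LieRingModule 𝔤 V] [LieModule ℂ 𝔤 V]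
variable (k : ℕ)

local notation "ι" => UniversalEnvelopingAlgebra.ι ℂ

/-- The operators in `End_{U𝔤}(M ⊗ V^{⊗ k})` that also commute with `Z(U𝔤)` acting on `M`. Unlike
`EndU`, this is an algebra over `Z(U𝔤)`. -/
def EndZ : Subalgebra ℂ (Module.End ℂ (TSpace M V k)) :=
  Subalgebra.centralizer ℂ
    (Set.range (partialAct 𝔤 M V (Fin.last k)) ∪ Set.range fun z : Z 𝔤 => slot 𝔤 M V 0 z)

theorem EndZ_le : EndZ 𝔤 M V k ≤ EndU 𝔤 M V k :=
  Subalgebra.centralizer_le _ _ _ Set.subset_union_left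

variable {𝔤 M V k}

theorem partialAct_last (x : 𝔤) :
    partialAct 𝔤 M V (Fin.last k) x = ∑ ℓ, slot 𝔤 M V ℓ (ι x) := by
  simp [partialAct, Fin.le_last]

theorem mem_EndZ {a : Module.End ℂ (TSpace M V k)}
    (h₁ : ∀ x : 𝔤, Commute (∑ ℓ, slot 𝔤 M V ℓ (ι x)) a)
    (h₂ : ∀ z : Z 𝔤, Commute (slot 𝔤 M V 0 z) a) : a ∈ EndZ 𝔤 M V k := by
  rw [EndZ, Subalgebra.mem_centralizer_iff]
  rintro _ (⟨x, rfl⟩ | ⟨z, rfl⟩)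
  · rw [partialAct_last]; exact h₁ x
  · exact h₂ z

theorem slot_mem_EndZ {u : U 𝔤} (hu : u ∈ Subalgebra.center ℂ (U 𝔤)) (ℓ : Fin (k + 1)) :
    slot 𝔤 M V ℓ u ∈ EndZ 𝔤 M V k :=
  mem_EndZ (fun _ => Commute.sum_left _ _ _ fun _ _ => (slot_commute_of_mem_center hu _ _ _).symm)
    fun z => slot_commute_of_mem_center z.2 _ _ _

theorem permOp_mem_EndZ (w : Equiv.Perm (Fin k)) : permOp M V w ∈ EndZ 𝔤 M V k := by
  refine mem_EndZ (fun x => ?_) fun z => ?_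
  · rw [commute_iff_eq, Finset.mul_sum, ← Equiv.sum_comp (extPerm w), Finset.sum_mul]
    exact Finset.sum_congr rfl fun ℓ _ => (permOp_mul_slot w ℓ _).symm
  · exact (permOp_mul_slot w 0 (z : U 𝔤)).symm

variable (𝔤 M V k) in
/-- The action of `Z(U𝔤)` on `M`, as a homomorphism to `EndZ`. -/
def scalarHom : Z 𝔤 →+* EndZ 𝔤 M V k :=
  (((slotHom 𝔤 M V 0).comp (Subalgebra.center ℂ (U 𝔤)).val).codRestrict (EndZ 𝔤 M V k)
    fun z => slot_mem_EndZ z.2 0).toRingHom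

instance : Algebra (Z 𝔤) (EndZ 𝔤 M V k) :=
  (scalarHom 𝔤 M V k).toAlgebra' fun z a => Subtype.ext
    ((Subalgebra.mem_centralizer_iff ℂ).1 a.2 _ (Or.inr ⟨z, rfl⟩))

theorem EndZ.algebraMap_val (z : Z 𝔤) :
    (algebraMap (Z 𝔤) (EndZ 𝔤 M V k) z).val = slot 𝔤 M V 0 z := rfl

variable [FiniteDimensional ℂ 𝔤] {F : LinearMap.BilinForm ℂ 𝔤} (hF : F.Nondegenerate)
  (hs : F.IsSymm) (hi : ∀ x y z, F ⁅x, y⁆ z = F x ⁅y, z⁆)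

include hs hi in
theorem slot₂_mem_EndZ {ℓ m : Fin (k + 1)} (h : ℓ ≠ m) :
    slot₂ 𝔤 M V ℓ m (gammaElt F hF) ∈ EndZ 𝔤 M V k := by
  refine mem_EndZ (fun x => ?_) fun z =>
    commute_slot₂_of_commute (fun _ => slot_commute_of_mem_center z.2 _ _ _)
      (fun _ => slot_commute_of_mem_center z.2 _ _ _) _
  rw [← Finset.add_sum_erase _ _ (Finset.mem_univ ℓ),
    ← Finset.add_sum_erase _ _ (Finset.mem_erase.2 ⟨h.symm, Finset.mem_univ m⟩), ← add_assoc]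
  refine (commute_slot₂_gammaElt_add hF hs hi h x).add_left (Commute.sum_left _ _ _ fun n hn => ?_)
  simp only [Finset.mem_erase, Finset.mem_univ, and_true] at hn
  exact commute_slot₂_of_commute (fun _ => slot_commute hn.2 _ _)
    (fun _ => slot_commute hn.1 _ _) _

/-- The operators `κ_ℓ`, `a + γ_{ℓ,m}` and the permutations of the factors `V` satisfy the
relations of the braid algebra. The case `a = 0` gives `Φ`; for `𝔰𝔩_r`, the case `a = 1/r` gives
`Φ'`. -/
def tensorData (a : ℂ) : BraidData (Z 𝔤) (EndZ 𝔤 M V k) k where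
  P := (permHom M V k).codRestrict (EndZ 𝔤 M V k) permOp_mem_EndZ
  K ℓ := ⟨slot 𝔤 M V ℓ (casimir F hF), slot_mem_EndZ (casimir_mem_center hF hs hi) ℓ⟩
  G ℓ m := if h : ℓ ≠ m then
    algebraMap ℂ _ a + ⟨slot₂ 𝔤 M V ℓ m (gammaElt F hF), slot₂_mem_EndZ hF hs hi h⟩ else 0
  K_comm i j := Subtype.ext (slot_commute_of_mem_center (casimir_mem_center hF hs hi) _ _ _)
  K_G i ℓ m h := by
    rw [dif_pos h]
    refine (Algebra.commute_algebraMap_right _ _).add_right (Subtype.ext ?_)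
    exact commute_slot₂_of_commute
      (fun _ => slot_commute_of_mem_center (casimir_mem_center hF hs hi) _ _ _)
      (fun _ => slot_commute_of_mem_center (casimir_mem_center hF hs hi) _ _ _) _
  P_K w i := Subtype.ext (permOp_mul_slot _ _ _)
  P_G w ℓ m h := by
    rw [dif_pos h, dif_pos ((extPerm w).injective.ne h), mul_add, add_mul, ← Algebra.commutes]
    exact congrArg _ (Subtype.ext (permOp_mul_slot₂ _ _ _ _))
  G_symm ℓ m h := by
    rw [dif_pos h, dif_pos h.symm]
    exact congrArg _ (Subtype.ext (slot₂_gammaElt_symm hF hs h))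
  G_disj ℓ m p q h₁ h₂ h₃ h₄ h₅ h₆ := by
    rw [dif_pos h₁, dif_pos h₂]
    refine (Algebra.commute_algebraMap_right _ _).add_right
      ((Algebra.commute_algebraMap_left _ _).add_left (Subtype.ext ?_))
    refine commute_slot₂_of_commute (fun u => ?_) (fun u => ?_) _
    · exact (commute_slot₂_of_commute (fun _ => slot_commute h₃.symm _ _)
        (fun _ => slot_commute h₅.symm _ _) _).symm
    · exact (commute_slot₂_of_commute (fun _ => slot_commute h₄.symm _ _)
        (fun _ => slot_commute h₆.symm _ _) _).symm
  G_tri ℓ m n h₁ h₂ h₃ := by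
    rw [dif_pos h₁, dif_pos h₂, dif_pos h₃, add_add_add_comm]
    refine (Commute.add_right ?_ ?_)
    · exact (Algebra.commute_algebraMap_right _ _).add_right (Algebra.commute_algebraMap_right _ _)
    · exact (Algebra.commute_algebraMap_left _ _).add_left
        (Subtype.ext (commute_slot₂_gammaElt_slot₂_add hF hs hi h₁ h₂ h₃))

theorem tensorData_G (a : ℂ) {ℓ m : Fin (k + 1)} (h : ℓ ≠ m) :
    ((tensorData hF hs hi a : BraidData (Z 𝔤) (EndZ 𝔤 M V k) k).G ℓ m).val =
      algebraMap ℂ _ a + slot₂ 𝔤 M V ℓ m (gammaElt F hF) := by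
  simp only [tensorData, dif_pos h]
  rfl

variable [NeZero k]

variable (M V k) in
/-- The representation of `𝓑_k` on `M ⊗ V^{⊗ k}` in which `γ_{ℓ,m}` acts as `a + γ`. -/
def tensorRep (a : ℂ) : Braid (Z 𝔤) k →+* EndU 𝔤 M V k :=
  (Subalgebra.inclusion (EndZ_le 𝔤 M V k)).toRingHom.comp
    (tensorData hF hs hi a).toHom.toRingHom

variable (a : ℂ)

theorem tensorRep_val (x : Braid (Z 𝔤) k) : (tensorRep M V k hF hs hi a x).val =
    ((tensorData hF hs hi a).toHom x).val := rfl

theorem tensorRep_scalar (z : Z 𝔤) :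
    (tensorRep M V k hF hs hi a (algebraMap (Z 𝔤) _ z)).val = slot 𝔤 M V 0 z := by
  rw [tensorRep_val, AlgHom.commutes]
  rfl

theorem tensorRep_t (w : Equiv.Perm (Fin k)) :
    (tensorRep M V k hF hs hi a (Braid.t _ w)).val = permOp M V w := by
  rw [tensorRep_val, BraidData.toHom_t]
  rfl

theorem tensorRep_κ₀ : (tensorRep M V k hF hs hi a (Braid.κ₀ _)).val =
    slot 𝔤 M V 0 (casimir F hF) := by
  rw [tensorRep_val, BraidData.toHom_κ₀]
  rfl

theorem tensorRep_κ (j : Fin (k + 1)) :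
    (tensorRep M V k hF hs hi a (Braid.κ _ j)).val = slot 𝔤 M V j (casimir F hF) := by
  rw [tensorRep_val, BraidData.toHom_κ]
  rfl

theorem tensorRep_γ {ℓ m : Fin (k + 1)} (h : ℓ ≠ m) :
    (tensorRep M V k hF hs hi a (Braid.γ _ ℓ m)).val =
      algebraMap ℂ _ a + slot₂ 𝔤 M V ℓ m (gammaElt F hF) := by
  rw [tensorRep_val, BraidData.toHom_γ _ h, tensorData_G hF hs hi a h]

theorem tensorRep_y (j : Fin k) : (tensorRep M V k hF hs hi a (Braid.y _ j)).val =
    (1 / 2 : ℂ) • slot 𝔤 M V j.succ (casimir F hF) +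
      ∑ ℓ : Fin (k + 1) with ℓ < j.succ,
        (algebraMap ℂ _ a + slot₂ 𝔤 M V ℓ j.succ (gammaElt F hF)) := by
  rw [tensorRep_val, BraidData.toHom_y, BraidData.Y, Subalgebra.coe_add, Subalgebra.coe_mul,
    AddSubmonoidClass.coe_finsetSum, EndZ.algebraMap_val]
  congr 1
  · have : ((algebraMap ℂ (Z 𝔤) (1 / 2) : Z 𝔤) : U 𝔤) = (1 / 2 : ℂ) • 1 :=
      Algebra.algebraMap_eq_smul_one _
    rw [this, map_smul, slot_one, smul_one_mul]
    rfl
  · exact Finset.sum_congr rfl fun ℓ hℓ =>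
      tensorData_G hF hs hi a (Finset.mem_filter.1 hℓ).2.ne

theorem tensorRep_e (i : ℕ) (h : i + 1 < k) :
    (tensorRep M V k hF hs hi a (Braid.e _ i h)).val =
      1 - (algebraMap ℂ _ a + slot₂ 𝔤 M V (Fin.succ ⟨i, by omega⟩) (Fin.succ ⟨i + 1, h⟩)
        (gammaElt F hF)) * permOp M V (adj i h) := by
  rw [tensorRep_val, BraidData.toHom_e, Subalgebra.coe_sub, Subalgebra.coe_mul,
    tensorData_G hF hs hi a (by simp)]
  rfl

omit [FiniteDimensional ℂ 𝔤] [NeZero k] in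
theorem partialAct_zero (x : 𝔤) : partialAct 𝔤 M V (0 : Fin (k + 1)) x = slot 𝔤 M V 0 (ι x) := by
  have : (Finset.univ.filter fun ℓ : Fin (k + 1) => ℓ ≤ 0) = {0} := by
    ext; simp
  rw [partialAct, this, Finset.sum_singleton]

omit [FiniteDimensional ℂ 𝔤] [NeZero k] in
theorem partialAct_succ (j : Fin k) (x : 𝔤) : partialAct 𝔤 M V j.succ x =
    partialAct 𝔤 M V j.castSucc x + slot 𝔤 M V j.succ (ι x) := by
  have : (Finset.univ.filter fun ℓ : Fin (k + 1) => ℓ ≤ j.succ) =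
      insert j.succ (Finset.univ.filter fun ℓ : Fin (k + 1) => ℓ ≤ j.castSucc) := by
    ext ℓ
    simp only [Finset.mem_filter, Finset.mem_univ, true_and, Finset.mem_insert, Fin.le_def,
      Fin.ext_iff, Fin.val_succ, Fin.val_castSucc]
    omega
  rw [partialAct, this, Finset.sum_insert (by simp [Fin.le_def]), add_comm]
  rfl

/-- Passing from `c_j` to `c_{j+1}` adds the diagonal term `κ_{j+1}` and, by the symmetry of `γ`,
two equal sums of terms `γ_{ℓ,j+1}`, together `2 y_{j+1}`. -/
theorem tensorRep_c (j : Fin (k + 1)) : (tensorRep M V k hF hs hi 0 (Braid.c _ j)).val =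
    ∑ i, partialAct 𝔤 M V j (Module.finBasis ℂ 𝔤 i) *
      partialAct 𝔤 M V j (F.dualBasis hF (Module.finBasis ℂ 𝔤) i) := by
  induction j using Fin.induction with
  | zero =>
    simp only [partialAct_zero, ← slot_casimir]
    simp only [Braid.c, Fin.val_zero, not_lt_zero, Finset.filter_false, Finset.sum_empty, mul_zero,
      add_zero]
    exact tensorRep_κ₀ hF hs hi 0
  | succ j ih =>
    have hc : Braid.c (Z 𝔤) j.succ = Braid.c (Z 𝔤) j.castSucc + 2 * Braid.y (Z 𝔤) j := by
      have : (Finset.univ.filter fun i : Fin k => i.val < j.succ.val) =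
          insert j (Finset.univ.filter fun i : Fin k => i.val < j.castSucc.val) := by
        ext ℓ
        simp only [Finset.mem_filter, Finset.mem_univ, true_and, Finset.mem_insert,
          Fin.ext_iff, Fin.val_succ, Fin.val_castSucc]
        omega
      rw [Braid.c, this, Finset.sum_insert (by simp), Braid.c]
      noncomm_ring
    have hΓ : ∑ i, partialAct 𝔤 M V j.castSucc (Module.finBasis ℂ 𝔤 i) *
        slot 𝔤 M V j.succ (ι (F.dualBasis hF (Module.finBasis ℂ 𝔤) i)) =
        ∑ ℓ : Fin (k + 1) with ℓ < j.succ, slot₂ 𝔤 M V ℓ j.succ (gammaElt F hF) := by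
      simp only [partialAct, slot₂_gammaElt, Finset.sum_mul, Fin.le_castSucc_iff]
      exact Finset.sum_comm
    have hΓ' : ∑ i, slot 𝔤 M V j.succ (ι (Module.finBasis ℂ 𝔤 i)) *
        partialAct 𝔤 M V j.castSucc (F.dualBasis hF (Module.finBasis ℂ 𝔤) i) =
        ∑ ℓ : Fin (k + 1) with ℓ < j.succ, slot₂ 𝔤 M V ℓ j.succ (gammaElt F hF) := by
      rw [Finset.sum_congr rfl fun ℓ hℓ =>
        slot₂_gammaElt_symm (M := M) (V := V) hF hs (Finset.mem_filter.1 hℓ).2.ne]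
      simp only [partialAct, slot₂_gammaElt, Finset.mul_sum, Fin.le_castSucc_iff]
      exact Finset.sum_comm
    rw [hc, map_add, map_mul, map_ofNat, two_mul, Subalgebra.coe_add, ih, Subalgebra.coe_add,
      tensorRep_y]
    simp only [partialAct_succ, add_mul, mul_add, Finset.sum_add_distrib, hΓ, hΓ', ← slot_casimir,
      map_zero, zero_add]
    module

theorem isTensorRep : IsTensorRep F hF (tensorRep M V k hF hs hi 0) where
  scalar := tensorRep_scalar hF hs hi 0
  perm := tensorRep_t hF hs hi 0
  kappa := tensorRep_κ hF hs hi 0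
  gamma ℓ m h := by rw [tensorRep_γ hF hs hi 0 h, map_zero, zero_add]
  y j := by simp only [tensorRep_y, map_zero, zero_add]
  c := tensorRep_c hF hs hi

theorem isShift : IsShift a (tensorRep M V k hF hs hi 0) (tensorRep M V k hF hs hi a) where
  scalar z := Subtype.ext (by simp only [tensorRep_scalar])
  perm w := Subtype.ext (by simp only [tensorRep_t])
  kappa j := Subtype.ext (by simp only [tensorRep_κ])
  gamma ℓ m h := Subtype.ext (by
    rw [Subalgebra.coe_add, tensorRep_γ hF hs hi a h, tensorRep_γ hF hs hi 0 h, map_zero, zero_add]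
    rfl)

end TensorRep

section Factors

variable {𝔤 : Type*} [LieRing 𝔤] [LieAlgebra ℂ 𝔤]
variable {M : Type*} [AddCommGroup M] [Module ℂ M] [LieRingModule 𝔤 M] [LieModule ℂ 𝔤 M]
variable {V : Type*} [AddCommGroup V] [Module ℂ V] [LieRingModule 𝔤 V] [LieModule ℂ 𝔤 V]
variable {k : ℕ}

theorem FactorsBMW.of_rel {ε : ℤˣ} {z : ℕ → Z 𝔤} {Φ : Braid (Z 𝔤) k →+* EndU 𝔤 M V k}
    (h : ∀ x y, BMWRel k ε z x y → Φ x = Φ y) : FactorsBMW ε z Φ := by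
  refine ⟨RingQuot.lift ⟨Φ, fun x y hxy => h x y hxy⟩, ?_⟩
  rw [BMW.mk, RingQuot.mkAlgHom_coe]
  ext x
  simp

/-- If all `e_i` act by zero then every relation of `𝓦_k` and of `𝓗_k` holds, whatever the
parameters. -/
theorem FactorsHecke.of_e_eq_zero (ε : ℤˣ) (z : ℕ → Z 𝔤) {Φ : Braid (Z 𝔤) k →+* EndU 𝔤 M V k}
    (h : ∀ i h, Φ (Braid.e _ i h) = 0) : FactorsHecke ε z Φ := by
  obtain ⟨Ψ, hΨ⟩ : FactorsBMW ε z Φ := FactorsBMW.of_rel fun x y hxy => by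
    cases hxy <;> simp [h, Algebra.smul_def]
  have hrel : ∀ ⦃x y⦄, HeckeRel k ε z x y → Ψ x = Ψ y := fun x y hxy => by
    obtain ⟨i, hi⟩ := hxy
    rw [map_zero, ← h i hi, ← hΨ]
    rfl
  have hlift : (RingQuot.lift ⟨Ψ, hrel⟩).comp (Hecke.mk k ε z : BMW k ε z →+* Hecke k ε z) = Ψ := by
    rw [Hecke.mk, RingQuot.mkAlgHom_coe]
    ext x
    simp
  exact ⟨RingQuot.lift ⟨Ψ, hrel⟩, by rw [hlift, hΨ]⟩

end Factors

/-! ### Tensors in `End(V) ⊗ End(V)` -/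

section MatrixUnits

variable (V : Type*) [AddCommGroup V] [Module ℂ V] [FiniteDimensional ℂ V]

local notation "bV" => Module.finBasis ℂ V

/-- The matrix unit `E_{ab}` with respect to the basis `Module.finBasis ℂ V`. -/
def matUnit (a b : Fin (Module.finrank ℂ V)) : Module.End ℂ V :=
  ((bV).coord b).smulRight (bV a)

variable {V}

@[simp] theorem matUnit_apply (a b : Fin (Module.finrank ℂ V)) (v : V) :
    matUnit V a b v = (bV).repr v b • bV a := rfl

theorem trace_matUnit_mul (a b : Fin (Module.finrank ℂ V)) (x : Module.End ℂ V) :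
    LinearMap.trace ℂ V (matUnit V b a * x) = (bV).repr (x (bV b)) a := by
  have : matUnit V b a * x = ((bV).coord a ∘ₗ x).smulRight (bV b) := by
    ext v; simp
  rw [this, LinearMap.trace_smulRight]
  rfl

theorem sum_trace_smul_matUnit (x : Module.End ℂ V) :
    ∑ a, ∑ b, LinearMap.trace ℂ V (matUnit V b a * x) • matUnit V a b = x := by
  refine (bV).ext fun c => ?_
  simp only [trace_matUnit_mul, LinearMap.sum_apply, LinearMap.smul_apply, matUnit_apply,
    Module.Basis.repr_self]
  conv_rhs => rw [← (bV).sum_repr (x (bV c))]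
  refine Finset.sum_congr rfl fun a _ => ?_
  rw [Finset.sum_eq_single c] <;> simp +contextual

theorem sum_trace_smul_matUnit' :
    ∑ a, ∑ b, LinearMap.trace ℂ V (matUnit V b a) • matUnit V a b = 1 := by
  simpa using sum_trace_smul_matUnit (1 : Module.End ℂ V)

/-- The tensor `∑ p(E_{ab}) ⊗ E_{ba}`, which corresponds to the linear map `p` under the pairing
`tr(xy)`. -/
def twist (p : Module.End ℂ V →ₗ[ℂ] Module.End ℂ V) : Module.End ℂ V ⊗[ℂ] Module.End ℂ V :=
  ∑ a, ∑ b, p (matUnit V a b) ⊗ₜ matUnit V b a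

theorem twist_sub (p q : Module.End ℂ V →ₗ[ℂ] Module.End ℂ V) :
    twist (p - q) = twist p - twist q := by
  simp only [twist, LinearMap.sub_apply, TensorProduct.sub_tmul, Finset.sum_sub_distrib]

/-- The functional `c · tr`, composed with the inclusion of the scalars, corresponds to the scalar
tensor `c`. -/
theorem twist_trace (c : ℂ) : twist ((c • LinearMap.trace ℂ V).smulRight (1 : Module.End ℂ V)) =
    c • (1 : Module.End ℂ V ⊗[ℂ] Module.End ℂ V) := by
  have := congrArg (fun x => c • (1 : Module.End ℂ V) ⊗ₜ[ℂ] x)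
    (sum_trace_smul_matUnit' (V := V))
  simp only [TensorProduct.tmul_sum, Finset.smul_sum, TensorProduct.tmul_smul] at this
  rw [Algebra.TensorProduct.one_def, ← this, twist, Finset.sum_comm]
  refine Finset.sum_congr rfl fun a _ => Finset.sum_congr rfl fun b _ => ?_
  simp [TensorProduct.smul_tmul', smul_smul]

theorem sum_matUnit_mul_matUnit :
    ∑ a, ∑ b, matUnit V a b * matUnit V b a =
      (Module.finrank ℂ V : ℂ) • (1 : Module.End ℂ V) := by
  refine LinearMap.ext fun v => ?_
  simp only [LinearMap.sum_apply, Module.End.mul_apply, matUnit_apply, map_smul,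
    Module.Basis.repr_self, Finsupp.single_eq_same, one_smul, Finset.sum_const, Finset.card_univ,
    Fintype.card_fin, ← Finset.smul_sum, (bV).sum_repr, LinearMap.smul_apply, Module.End.one_apply,
    Nat.cast_smul_eq_nsmul]

section Factors

variable {M : Type*} [AddCommGroup M] [Module ℂ M] {k : ℕ}

/-- The tensor `∑ E_{ab} ⊗ E_{ba}` acts by exchanging two factors. -/
theorem factor₂_twist_id {i j : Fin k} (h : i ≠ j) :
    factor₂ M V h (twist LinearMap.id) = permOp M V (Equiv.swap i j) := by
  refine TSpace.hom_ext fun m v => ?_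
  simp only [twist, map_sum, factor₂_tmul, LinearMap.sum_apply, Module.End.mul_apply, factor_tmul,
    LinearMap.id_apply, permOp_tmul, Equiv.symm_swap, matUnit_apply, ← TensorProduct.tmul_sum]
  congr 1
  have h1 : (fun l => v (Equiv.swap i j l)) =
      Function.update (Function.update v j (v i)) i (v j) := by
    ext l
    rw [Equiv.swap_apply_def]
    by_cases hi : l = i
    · subst hi; simp
    · by_cases hj : l = j
      · subst hj; simp [hi]
      · simp [hi, hj]
  rw [h1]
  -- Expand both moved vectors in the basis; the terms match one by one.
  conv_rhs => rw [← (bV).sum_repr (v j)]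
  rw [MultilinearMap.map_update_sum]
  refine Finset.sum_congr rfl fun a _ => ?_
  rw [Function.update_comm h.symm]
  conv_rhs => rw [← (bV).sum_repr (v i)]
  rw [MultilinearMap.map_update_sum]
  refine Finset.sum_congr rfl fun b _ => ?_
  rw [Function.update_of_ne h]
  rw [MultilinearMap.map_update_smul, MultilinearMap.map_update_smul, Function.update_comm h.symm,
    MultilinearMap.map_update_smul]
  conv_rhs =>
    rw [Function.update_comm h, MultilinearMap.map_update_smul, Function.update_comm h.symm]

theorem permOp_swap_eq_sum {i j : Fin k} (h : i ≠ j) : permOp M V (Equiv.swap i j) =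
    ∑ a, ∑ b, factor M V i (matUnit V a b) * factor M V j (matUnit V b a) := by
  rw [← factor₂_twist_id h]
  simp [twist]

/-- If `q` does not involve the `i`-th factor and `q x q = tr(x) q` for `x` in the `j`-th factor,
then `q` absorbs the exchange of these two factors. -/
theorem mul_permOp_swap_mul {i j : Fin k} (h : i ≠ j) {q : Module.End ℂ (TSpace M V k)}
    (h₁ : ∀ x, Commute q (factor M V i x))
    (h₂ : ∀ x, q * factor M V j x * q = LinearMap.trace ℂ V x • q) :
    q * permOp M V (Equiv.swap i j) * q = q := by
  have h3 : ∀ x y, q * (factor M V i x * factor M V j y) * q =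
      factor M V i (LinearMap.trace ℂ V y • x) * q := fun x y => by
    rw [← mul_assoc, (h₁ x).eq, mul_assoc, mul_assoc, ← mul_assoc q, h₂, map_smul, mul_smul_comm,
      smul_mul_assoc]
  rw [permOp_swap_eq_sum h]
  simp only [Finset.mul_sum, Finset.sum_mul, h3]
  simp only [← Finset.sum_mul, ← map_sum]
  rw [sum_trace_smul_matUnit', map_one, one_mul]

end Factors

variable {𝔤 : Type*} [LieRing 𝔤] [LieAlgebra ℂ 𝔤] [LieRingModule 𝔤 V] [LieModule ℂ 𝔤 V]

local notation "ι" => UniversalEnvelopingAlgebra.ι ℂ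

omit [FiniteDimensional ℂ V] in
theorem rep_ι (x : 𝔤) : rep 𝔤 V (ι x) = LieModule.toEnd ℂ 𝔤 V x :=
  UniversalEnvelopingAlgebra.lift_ι_apply ..

omit [FiniteDimensional ℂ V] in
theorem slot₂_succ_succ {M : Type*} [AddCommGroup M] [Module ℂ M] [LieRingModule 𝔤 M]
    [LieModule ℂ 𝔤 M] {k : ℕ} {i j : Fin k} (h : i ≠ j) (g : U 𝔤 ⊗[ℂ] U 𝔤) :
    slot₂ 𝔤 M V i.succ j.succ g =
      factor₂ M V h (Algebra.TensorProduct.map (rep 𝔤 V) (rep 𝔤 V) g) := by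
  induction g using TensorProduct.induction_on with
  | zero => rw [map_zero, map_zero, map_zero]
  | tmul u v => rw [slot₂_tmul, slot_succ, slot_succ, Algebra.TensorProduct.map_tmul, factor₂_tmul]
  | add a b ha hb => rw [map_add, map_add, map_add, ha, hb]

/-- If the form `F` on `𝔤` and the trace form of `V` are related by a projection
`p : End(V) → 𝔤`, then `γ` acts on `V ⊗ V` as `∑ p(E_{ab}) ⊗ E_{ba}`. -/
theorem map_gammaElt_eq_twist [FiniteDimensional ℂ 𝔤] {F : LinearMap.BilinForm ℂ 𝔤}
    (hF : F.Nondegenerate) (hs : F.IsSymm) (p : Module.End ℂ V →ₗ[ℂ] 𝔤)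
    (hp : ∀ x y, F (p x) y = LinearMap.trace ℂ V (x * LieModule.toEnd ℂ 𝔤 V y)) :
    Algebra.TensorProduct.map (rep 𝔤 V) (rep 𝔤 V) (gammaElt F hF) =
      twist ((LieModule.toEnd ℂ 𝔤 V).toLinearMap ∘ₗ p) := by
  have h1 (y : 𝔤) : LieModule.toEnd ℂ 𝔤 V y =
      ∑ a, ∑ b, F (p (matUnit V b a)) y • matUnit V a b := by
    simp only [hp]
    exact (sum_trace_smul_matUnit _).symm
  simp only [gammaElt, map_sum, Algebra.TensorProduct.map_tmul, rep_ι]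
  simp only [h1 (F.dualBasis hF (Module.finBasis ℂ 𝔤) _), TensorProduct.tmul_sum]
  rw [Finset.sum_comm, twist]
  refine Eq.trans (Finset.sum_congr rfl fun a _ => ?_) Finset.sum_comm
  rw [Finset.sum_comm]
  refine Finset.sum_congr rfl fun b _ => ?_
  simp only [TensorProduct.tmul_smul, TensorProduct.smul_tmul']
  rw [← TensorProduct.sum_tmul]
  congr 1
  conv_rhs => rw [LinearMap.comp_apply, ← sum_form_dual_smul hF hs (p (matUnit V b a))]
  simp only [map_sum, map_smul]
  rfl

end MatrixUnits

/-! ### Centrality of the parameters -/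

section PartialTrace

variable {𝔤 : Type*} [LieRing 𝔤] [LieAlgebra ℂ 𝔤]
variable (V : Type*) [AddCommGroup V] [Module ℂ V]

local notation "ι" => UniversalEnvelopingAlgebra.ι ℂ

variable (𝔤) in
/-- The partial trace `id ⊗ tr_V` on `U𝔤 ⊗ End(V)`. -/
def partialTrace : U 𝔤 ⊗[ℂ] Module.End ℂ V →ₗ[ℂ] U 𝔤 :=
  (TensorProduct.rid ℂ (U 𝔤)).toLinearMap ∘ₗ LinearMap.lTensor (U 𝔤) (LinearMap.trace ℂ V)

variable {V}

@[simp] theorem partialTrace_tmul (u : U 𝔤) (x : Module.End ℂ V) :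
    partialTrace 𝔤 V (u ⊗ₜ x) = LinearMap.trace ℂ V x • u := by
  simp [partialTrace]

/-- The partial trace carries the commutator with `x ⊗ 1 + 1 ⊗ y` to the commutator with `x`, since
the trace vanishes on commutators with `y`. -/
theorem partialTrace_commutator (x : 𝔤) (y : Module.End ℂ V) (T : U 𝔤 ⊗[ℂ] Module.End ℂ V) :
    partialTrace 𝔤 V ((ι x ⊗ₜ 1 + 1 ⊗ₜ y) * T - T * (ι x ⊗ₜ 1 + 1 ⊗ₜ y)) =
      ι x * partialTrace 𝔤 V T - partialTrace 𝔤 V T * ι x := by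
  induction T using TensorProduct.induction_on with
  | zero => simp
  | tmul u z =>
    simp only [add_mul, mul_add, Algebra.TensorProduct.tmul_mul_tmul, one_mul, mul_one, map_sub,
      map_add, partialTrace_tmul, LinearMap.trace_mul_comm ℂ z y, mul_smul_comm, smul_mul_assoc]
    abel
  | add a b ha hb =>
    rw [mul_add _ a, add_mul a, add_sub_add_comm, map_add, ha, hb, map_add, mul_add, add_mul,
      add_sub_add_comm]

variable [LieRingModule 𝔤 V] [LieModule ℂ 𝔤 V] [FiniteDimensional ℂ 𝔤]
  {F : LinearMap.BilinForm ℂ 𝔤} (hF : F.Nondegenerate)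
  (hs : F.IsSymm) (hi : ∀ x y z, F ⁅x, y⁆ z = F x ⁅y, z⁆)

include hs hi in
theorem commute_map_gammaElt (x : 𝔤) : Commute (ι x ⊗ₜ 1 + 1 ⊗ₜ rep 𝔤 V (ι x))
    (Algebra.TensorProduct.map (AlgHom.id ℂ (U 𝔤)) (rep 𝔤 V) (gammaElt F hF)) := by
  have h1 := sum_basis_dual_invariant hF hs hi
    ((TensorProduct.mk ℂ (U 𝔤) (Module.End ℂ V)).compl₁₂ (ι : 𝔤 →ₗ⁅ℂ⁆ U 𝔤).toLinearMap
      ((rep 𝔤 V).toLinearMap ∘ₗ (ι : 𝔤 →ₗ⁅ℂ⁆ U 𝔤).toLinearMap)) x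
  simp only [LinearMap.compl₁₂_apply, LinearMap.comp_apply, TensorProduct.mk_apply,
    LieHom.coe_toLinearMap, LieHom.map_lie, LieRing.of_associative_ring_bracket,
    AlgHom.toLinearMap_apply, map_sub, map_mul, LinearMap.sub_apply] at h1
  simp only [gammaElt, map_sum, Algebra.TensorProduct.map_tmul, AlgHom.id_apply]
  rw [commute_iff_eq, ← sub_eq_zero, Finset.mul_sum, Finset.sum_mul,
    ← Finset.sum_sub_distrib, ← h1]
  refine Finset.sum_congr rfl fun i _ => ?_
  simp only [add_mul, mul_add, Algebra.TensorProduct.tmul_mul_tmul, one_mul, mul_one]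
  abel

include hs hi in
/-- The parameters are central because `½ y + γ`, hence each of its powers, commutes with the
diagonal action of `𝔤`, whose second half the trace kills. -/
theorem zParam_mem_center (ε : ℤˣ) (y : ℂ) (ℓ : ℕ) :
    zParam V F hF ε y ℓ ∈ Subalgebra.center ℂ (U 𝔤) := by
  refine zsmul_mem (mem_center_of_commute_ι fun x => ?_) _
  set X : U 𝔤 ⊗[ℂ] Module.End ℂ V := (y / 2) • 1 +
    Algebra.TensorProduct.map (AlgHom.id ℂ (U 𝔤)) (rep 𝔤 V) (gammaElt F hF) with hX
  have h1 : Commute (ι x ⊗ₜ 1 + 1 ⊗ₜ rep 𝔤 V (ι x)) (X ^ ℓ) :=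
    (((Commute.one_right _).smul_right _).add_right
      (commute_map_gammaElt hF hs hi x)).pow_right ℓ
  have h2 := partialTrace_commutator x (rep 𝔤 V (ι x)) (X ^ ℓ)
  rw [h1.eq, sub_self, map_zero] at h2
  exact (sub_eq_zero.1 h2.symm : _)

end PartialTrace

/-! ### The general and special linear Lie algebras -/

section Linear

section

variable {V : Type*} [AddCommGroup V] [Module ℂ V]

theorem glForm_isSymm : (glForm V).IsSymm := ⟨LieModule.traceForm_comm ℂ (Module.End ℂ V) V⟩

theorem glForm_lie (x y z : Module.End ℂ V) : glForm V ⁅x, y⁆ z = glForm V x ⁅y, z⁆ :=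
  LieModule.traceForm_apply_lie_apply ..

theorem slForm_isSymm : (slForm V).IsSymm := ⟨LieModule.traceForm_comm ℂ (sl V) V⟩

theorem slForm_lie (x y z : sl V) : slForm V ⁅x, y⁆ z = slForm V x ⁅y, z⁆ :=
  LieModule.traceForm_apply_lie_apply ..

end

variable {V : Type*} [AddCommGroup V] [Module ℂ V] [FiniteDimensional ℂ V] {k : ℕ} [NeZero k]

section

variable {𝔤 : Type*} [LieRing 𝔤] [LieAlgebra ℂ 𝔤] [FiniteDimensional ℂ 𝔤]
  [LieRingModule 𝔤 V] [LieModule ℂ 𝔤 V]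
variable {M : Type*} [AddCommGroup M] [Module ℂ M] [LieRingModule 𝔤 M] [LieModule ℂ 𝔤 M]
variable {F : LinearMap.BilinForm ℂ 𝔤} (hF : F.Nondegenerate)
  (hs : F.IsSymm) (hi : ∀ x y z, F ⁅x, y⁆ z = F x ⁅y, z⁆)

/-- If `a + γ` exchanges the factors of `V ⊗ V` then the `e_i` act by zero. -/
theorem factorsHecke_tensorRep (a : ℂ)
    (h : a • 1 + Algebra.TensorProduct.map (rep 𝔤 V) (rep 𝔤 V) (gammaElt F hF) =
      twist LinearMap.id)
    (ε : ℤˣ) (z : ℕ → Z 𝔤) : FactorsHecke ε z (tensorRep M V k hF hs hi a) := by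
  refine FactorsHecke.of_e_eq_zero ε z fun i hi' => Subtype.ext ?_
  have hne : (⟨i, by omega⟩ : Fin k) ≠ ⟨i + 1, hi'⟩ := by simp
  rw [tensorRep_e, slot₂_succ_succ hne]
  have h1 : algebraMap ℂ (Module.End ℂ (TSpace M V k)) a +
      factor₂ M V hne (Algebra.TensorProduct.map (rep 𝔤 V) (rep 𝔤 V) (gammaElt F hF)) =
      permOp M V (adj i hi') := by
    rw [adj, ← factor₂_twist_id hne, ← h, map_add, ← Algebra.algebraMap_eq_smul_one,
      AlgHom.commutes]
  rw [h1, ← permHom_apply, ← map_mul, adj_mul_adj, map_one, sub_self]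
  rfl

end

variable (V) in
theorem map_gammaElt_gl :
    Algebra.TensorProduct.map (rep (Module.End ℂ V) V) (rep (Module.End ℂ V) V)
      (gammaElt (glForm V) glForm_nondegenerate) = twist LinearMap.id := by
  have h := map_gammaElt_eq_twist (V := V) (F := glForm V) glForm_nondegenerate glForm_isSymm
    LinearMap.id fun x y => glForm_apply x y
  rw [h]
  rfl

/-- The projection `x ↦ x - tr(x)/r` of `𝔤𝔩(V)` onto `𝔰𝔩(V)`. -/
def slProj (V : Type*) [AddCommGroup V] [Module ℂ V] [FiniteDimensional ℂ V] [Nontrivial V] :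
    Module.End ℂ V →ₗ[ℂ] sl V :=
  (LinearMap.id - (((Module.finrank ℂ V : ℂ)⁻¹) • LinearMap.trace ℂ V).smulRight
    (1 : Module.End ℂ V)).codRestrict (sl V).toSubmodule fun x => by
    have hr : (Module.finrank ℂ V : ℂ) ≠ 0 := by
      exact_mod_cast (Module.finrank_pos (R := ℂ) (M := V)).ne'
    change LinearMap.trace ℂ V _ = 0
    simp [LinearMap.trace_one]
    field_simp
    ring

theorem map_gammaElt_sl [Nontrivial V] :
    (1 / (Module.finrank ℂ V : ℂ)) • 1 + Algebra.TensorProduct.map (rep (sl V) V) (rep (sl V) V)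
      (gammaElt (slForm V) slForm_nondegenerate) = twist LinearMap.id := by
  rw [map_gammaElt_eq_twist slForm_nondegenerate slForm_isSymm (slProj V) fun x y => ?_]
  · have : (LieModule.toEnd ℂ (sl V) V).toLinearMap ∘ₗ slProj V = LinearMap.id -
        (((Module.finrank ℂ V : ℂ)⁻¹) • LinearMap.trace ℂ V).smulRight (1 : Module.End ℂ V) := rfl
    rw [this, twist_sub, twist_trace, one_div, add_sub_cancel]
  · have h2 : LinearMap.trace ℂ V (y : Module.End ℂ V) = 0 := y.2
    have h3 : (LieModule.toEnd ℂ (sl V) V y) = (y : Module.End ℂ V) := rfl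
    have h4 : (slProj V x : Module.End ℂ V) =
        x - ((Module.finrank ℂ V : ℂ)⁻¹ * LinearMap.trace ℂ V x) • 1 := rfl
    rw [slForm_apply, h3, h4, sub_mul, map_sub, smul_mul_assoc, one_mul, map_smul, h2, smul_zero,
      sub_zero]

end Linear

/-! ### The contraction attached to a bilinear form -/

section Contraction

variable {V : Type*} [AddCommGroup V] [Module ℂ V]

variable (V) in
/-- The action of `End(V) ⊗ End(V)` on `V ⊗ V`. -/
def tensorAct : Module.End ℂ V ⊗[ℂ] Module.End ℂ V →ₐ[ℂ] Module.End ℂ (V ⊗[ℂ] V) :=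
  Module.endTensorEndAlgHom (R := ℂ) (S := ℂ) (A := ℂ) (M := V) (N := V)

@[simp] theorem tensorAct_tmul (x y : Module.End ℂ V) (v w : V) :
    tensorAct V (x ⊗ₜ y) (v ⊗ₜ w) = x v ⊗ₜ y w := rfl

variable [FiniteDimensional ℂ V]

theorem tensorAct_injective : Function.Injective (tensorAct V) := by
  have h : ∀ g, tensorAct V g = homTensorHomEquiv ℂ V V V V g := fun g => by
    induction g using TensorProduct.induction_on with
    | zero => rw [map_zero, map_zero]
    | tmul x y => exact TensorProduct.ext' fun v w => by simp
    | add a b ha hb => rw [map_add, map_add, ha, hb]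
  intro a b hab
  rw [h, h] at hab
  exact (homTensorHomEquiv ℂ V V V V).injective hab

theorem tensorAct_ext {g g' : Module.End ℂ V ⊗[ℂ] Module.End ℂ V}
    (h : ∀ v w, tensorAct V g (v ⊗ₜ w) = tensorAct V g' (v ⊗ₜ w)) : g = g' :=
  tensorAct_injective (TensorProduct.ext' h)

local notation "bV" => Module.finBasis ℂ V

theorem tensorAct_twist_id (v w : V) :
    tensorAct V (twist LinearMap.id) (v ⊗ₜ w) = w ⊗ₜ v := by
  simp only [twist, map_sum, LinearMap.sum_apply, tensorAct_tmul, LinearMap.id_apply,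
    matUnit_apply]
  conv_rhs => rw [← (bV).sum_repr w, ← (bV).sum_repr v]
  simp only [TensorProduct.sum_tmul, TensorProduct.tmul_sum]
  rw [Finset.sum_comm]
  refine Finset.sum_congr rfl fun a _ => Finset.sum_congr rfl fun b _ => ?_
  rw [TensorProduct.smul_tmul_smul, TensorProduct.smul_tmul_smul, mul_comm]

variable (β : LinearMap.BilinForm ℂ V) (hβ : β.Nondegenerate)

/-- The adjoint `θ` on `End(V)` with respect to `β`, with `β(θ(z) v, w) = β(v, z w)`. -/
def adjoint : Module.End ℂ V →ₗ[ℂ] Module.End ℂ V :=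
  (LinearEquiv.conj (LinearMap.BilinForm.toDual β hβ).symm).toLinearMap ∘ₗ
    Module.Dual.transpose

local notation "θ" => adjoint β hβ

local notation "dV" => LinearMap.BilinForm.dualBasis β hβ (Module.finBasis ℂ V)

/-- The tensor `∑ v^b ⊗ v_b` of a basis and its dual basis. -/
def dualTensor : V ⊗[ℂ] V := ∑ b, dV b ⊗ₜ[ℂ] bV b

/-- The tensor `Q ∈ End(V) ⊗ End(V)` whose action on `V ⊗ V` is the contraction by `β` followed by
the insertion of the dual tensor. -/
def contr : Module.End ℂ V ⊗[ℂ] Module.End ℂ V := twist θ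

variable {β}

theorem form_adjoint_left (z : Module.End ℂ V) (v w : V) : β (θ z v) w = β v (z w) := by
  have hT : ∀ v w, LinearMap.BilinForm.toDual β hβ v w = β v w :=
    fun v w => LinearMap.BilinForm.toDual_def hβ
  rw [← hT]
  simp [adjoint, LinearEquiv.conj_apply, hT, Module.Dual.transpose_apply]

omit [FiniteDimensional ℂ V] in
include hβ in
theorem form_ext {v w : V} (h : ∀ u, β v u = β w u) : v = w :=
  sub_eq_zero.1 (hβ.1 _ fun u => by rw [map_sub, LinearMap.sub_apply, h, sub_self])

theorem form_dual_left (b : Fin (Module.finrank ℂ V)) (w : V) : β (dV b) w = (bV).repr w b := by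
  conv_lhs => rw [← (bV).sum_repr w]
  simp only [map_sum, map_smul, LinearMap.BilinForm.apply_dualBasis_left, smul_eq_mul, mul_ite,
    mul_one, mul_zero, Finset.sum_ite_eq', Finset.mem_univ, if_true]

theorem sum_form_smul_dualBasis (v : V) : ∑ b, β v (bV b) • dV b = v := by
  conv_rhs => rw [← (dV).sum_repr v]
  simp only [LinearMap.BilinForm.dualBasis_repr_apply]

theorem sum_form_dualBasis_smul (v : V) : ∑ b, β (dV b) v • bV b = v := by
  simp only [form_dual_left]
  exact (bV).sum_repr v

theorem adjoint_matUnit_apply (a b : Fin (Module.finrank ℂ V)) (v : V) :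
    θ (matUnit V a b) v = β v (bV a) • dV b :=
  form_ext hβ fun u => by
    rw [form_adjoint_left, matUnit_apply, map_smul, map_smul, LinearMap.smul_apply,
      form_dual_left, smul_eq_mul, smul_eq_mul, mul_comm]

theorem tensorAct_contr (v w : V) :
    tensorAct V (contr β hβ) (v ⊗ₜ w) = β v w • dualTensor β hβ := by
  simp only [contr, twist, map_sum, LinearMap.sum_apply, tensorAct_tmul, adjoint_matUnit_apply,
    matUnit_apply, dualTensor]
  conv_rhs => rw [← (bV).sum_repr w]
  simp only [map_sum, map_smul, Finset.sum_smul, Finset.smul_sum]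
  rw [Finset.sum_comm]
  refine Finset.sum_congr rfl fun a _ => Finset.sum_congr rfl fun b _ => ?_
  simp only [TensorProduct.tmul_smul, TensorProduct.smul_tmul', smul_smul, smul_eq_mul]

theorem trace_eq_sum_form (x : Module.End ℂ V) :
    LinearMap.trace ℂ V x = ∑ b, β (dV b) (x (bV b)) := by
  rw [LinearMap.trace_eq_matrix_trace ℂ bV, Matrix.trace]
  simp [LinearMap.toMatrix_apply, form_dual_left]

theorem trace_eq_sum_form' (x : Module.End ℂ V) :
    LinearMap.trace ℂ V x = ∑ b, β (x (dV b)) (bV b) := by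
  rw [LinearMap.trace_eq_matrix_trace ℂ dV, Matrix.trace]
  simp [LinearMap.toMatrix_apply]

/-- Contracting the dual tensor after `x` acts on it computes the trace of `x`. -/
theorem contr_mul_left_mul_contr (x : Module.End ℂ V) :
    contr β hβ * (x ⊗ₜ 1) * contr β hβ = LinearMap.trace ℂ V x • contr β hβ :=
  tensorAct_ext fun v w => by
    simp only [map_mul, map_smul, Module.End.mul_apply, tensorAct_contr, LinearMap.smul_apply]
    rw [dualTensor, map_sum]
    simp only [tensorAct_tmul, Module.End.one_apply, map_sum, tensorAct_contr]
    rw [← Finset.sum_smul, ← trace_eq_sum_form', ← dualTensor, smul_comm]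

theorem contr_mul_right_mul_contr (x : Module.End ℂ V) :
    contr β hβ * (1 ⊗ₜ x) * contr β hβ = LinearMap.trace ℂ V x • contr β hβ :=
  tensorAct_ext fun v w => by
    simp only [map_mul, map_smul, Module.End.mul_apply, tensorAct_contr, LinearMap.smul_apply]
    rw [dualTensor, map_sum]
    simp only [tensorAct_tmul, Module.End.one_apply, map_sum, tensorAct_contr]
    rw [← Finset.sum_smul, ← trace_eq_sum_form, ← dualTensor, smul_comm]

/-- The form `β` is killed by `x ⊗ 1 + 1 ⊗ x` for skew `x`. -/
theorem contr_mul_skew {x : Module.End ℂ V} (hx : ∀ v w, β (x v) w = -β v (x w)) :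
    contr β hβ * (x ⊗ₜ 1) = -(contr β hβ * (1 ⊗ₜ x)) :=
  tensorAct_ext fun v w => by
    rw [map_neg, LinearMap.neg_apply]
    simp only [map_mul, Module.End.mul_apply, tensorAct_contr, tensorAct_tmul,
      Module.End.one_apply, hx, neg_smul]

/-- The dual tensor is killed by `x ⊗ 1 + 1 ⊗ x` for skew `x`. -/
theorem skew_mul_contr {x : Module.End ℂ V} (hx : ∀ v w, β (x v) w = -β v (x w)) :
    (x ⊗ₜ 1) * contr β hβ = -((1 ⊗ₜ x) * contr β hβ) :=
  tensorAct_ext fun v w => by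
    rw [map_neg, LinearMap.neg_apply]
    simp only [map_mul, Module.End.mul_apply, tensorAct_contr, map_smul]
    rw [← smul_neg]
    congr 1
    simp only [dualTensor, map_sum, tensorAct_tmul, Module.End.one_apply]
    have h1 (b) : x (dV b) = ∑ c, β (x (dV b)) (bV c) • dV c :=
      (sum_form_smul_dualBasis hβ _).symm
    have h2 (b) : x (bV b) = ∑ c, β (dV c) (x (bV b)) • bV c :=
      (sum_form_dualBasis_smul hβ _).symm
    calc ∑ b, x (dV b) ⊗ₜ[ℂ] bV b
        = ∑ b, ∑ c, β (x (dV b)) (bV c) • dV c ⊗ₜ[ℂ] bV b := by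
          refine Finset.sum_congr rfl fun b _ => ?_
          conv_lhs => rw [h1 b, TensorProduct.sum_tmul]
          rfl
      _ = ∑ b, ∑ c, -(β (dV c) (x (bV b)) • dV b ⊗ₜ[ℂ] bV c) := by
          rw [Finset.sum_comm]
          simp only [hx, neg_smul]
      _ = -∑ b, dV b ⊗ₜ[ℂ] x (bV b) := by
          simp only [Finset.sum_neg_distrib]
          congr 1
          refine Finset.sum_congr rfl fun b _ => ?_
          conv_rhs => rw [h2 b, TensorProduct.tmul_sum]
          simp only [TensorProduct.tmul_smul]

variable {ε : ℤˣ} (hsym : ∀ v w, β v w = ((ε : ℤ) : ℂ) * β w v)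

theorem sign_mul_self (ε : ℤˣ) : ((ε : ℤ) : ℂ) * ((ε : ℤ) : ℂ) = 1 := by
  rcases Int.units_eq_one_or ε with rfl | rfl <;> simp

include hsym

theorem contr_mul_twist_id :
    contr β hβ * twist LinearMap.id = ((ε : ℤ) : ℂ) • contr β hβ :=
  tensorAct_ext fun v w => by
    simp only [map_mul, map_smul, Module.End.mul_apply, tensorAct_contr, LinearMap.smul_apply,
      tensorAct_twist_id]
    rw [hsym w v, mul_smul]

/-- The dual tensor has the same symmetry as the form. -/
theorem twist_id_mul_contr :
    twist LinearMap.id * contr β hβ = ((ε : ℤ) : ℂ) • contr β hβ :=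
  tensorAct_ext fun v w => by
    simp only [map_mul, map_smul, Module.End.mul_apply, tensorAct_contr, LinearMap.smul_apply]
    rw [smul_comm]
    congr 1
    simp only [dualTensor, map_sum, tensorAct_twist_id]
    have h1 (b) : bV b = ∑ c, β (bV b) (bV c) • dV c := (sum_form_smul_dualBasis hβ _).symm
    calc ∑ b, bV b ⊗ₜ[ℂ] dV b
        = ∑ b, ∑ c, β (bV b) (bV c) • dV c ⊗ₜ[ℂ] dV b := by
          refine Finset.sum_congr rfl fun b _ => ?_
          conv_lhs => rw [h1 b, TensorProduct.sum_tmul]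
          rfl
      _ = ∑ b, ∑ c, ((ε : ℤ) : ℂ) • β (bV b) (bV c) • dV b ⊗ₜ[ℂ] dV c := by
          rw [Finset.sum_comm]
          refine Finset.sum_congr rfl fun b _ => Finset.sum_congr rfl fun c _ => ?_
          rw [hsym, mul_smul]
      _ = ((ε : ℤ) : ℂ) • ∑ b, dV b ⊗ₜ[ℂ] bV b := by
          simp only [← Finset.smul_sum]
          congr 1
          refine Finset.sum_congr rfl fun b _ => ?_
          conv_rhs => rw [h1 b, TensorProduct.tmul_sum]
          simp only [TensorProduct.tmul_smul]

theorem sum_adjoint_matUnit_mul_matUnit :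
    ∑ a, ∑ b, θ (matUnit V a b) * matUnit V b a = ((ε : ℤ) : ℂ) • (1 : Module.End ℂ V) := by
  refine LinearMap.ext fun v => ?_
  simp only [LinearMap.sum_apply, Module.End.mul_apply, matUnit_apply, map_smul,
    adjoint_matUnit_apply, LinearMap.smul_apply, Module.End.one_apply]
  rw [Finset.sum_comm]
  conv_rhs => rw [← sum_form_smul_dualBasis hβ v, Finset.smul_sum]
  refine Finset.sum_congr rfl fun b _ => ?_
  rw [smul_smul, ← hsym]
  conv_rhs => rw [← (bV).sum_repr v]
  simp only [map_sum, map_smul, Finset.sum_smul, smul_smul, smul_eq_mul]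

/-- The projection `1 - θ` of `𝔤𝔩(V)` to the orthogonal or symplectic Lie algebra. It is twice
the orthogonal projection, which accounts for the factor `½` in the form. -/
def skewProj : Module.End ℂ V →ₗ[ℂ] skewAdjointLieSubalgebra β :=
  (LinearMap.id - θ).codRestrict (skewAdjointLieSubalgebra β).toSubmodule fun z v w => by
    have h : β v (θ z w) = β (z v) w := by
      rw [hsym v, form_adjoint_left, hsym w, ← mul_assoc, sign_mul_self, one_mul]
    simp only [LinearMap.sub_apply, LinearMap.id_apply, LinearMap.neg_apply, map_sub,
      form_adjoint_left, h]
    ring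

end Contraction

/-! ### The orthogonal and symplectic Lie algebras -/

section SoSp

local notation "ι" => UniversalEnvelopingAlgebra.ι ℂ

section

variable {V : Type*} [AddCommGroup V] [Module ℂ V] (β : LinearMap.BilinForm ℂ V)

theorem soSpForm_isSymm : (soSpForm β).IsSymm :=
  ⟨fun x y => by simp only [soSpForm_apply, LinearMap.trace_mul_comm ℂ (x : Module.End ℂ V) y]⟩

theorem soSpForm_lie (x y z : skewAdjointLieSubalgebra β) :
    soSpForm β ⁅x, y⁆ z = soSpForm β x ⁅y, z⁆ :=
  congrArg ((1 / 2 : ℂ) * ·)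
    (LieModule.traceForm_apply_lie_apply ℂ (skewAdjointLieSubalgebra β) V x y z)

variable {β} in
theorem toEnd_skew (x : skewAdjointLieSubalgebra β) (v w : V) :
    β (LieModule.toEnd ℂ (skewAdjointLieSubalgebra β) V x v) w =
      -β v (LieModule.toEnd ℂ (skewAdjointLieSubalgebra β) V x w) := by
  have := x.2 v w
  simpa using this

end

variable {V : Type*} [AddCommGroup V] [Module ℂ V] [FiniteDimensional ℂ V]
  {β : LinearMap.BilinForm ℂ V} (hβ : β.Nondegenerate) {ε : ℤˣ}
  (hsym : ∀ v w, β v w = ((ε : ℤ) : ℂ) * β w v)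

theorem trace_adjoint (z : Module.End ℂ V) :
    LinearMap.trace ℂ V (adjoint β hβ z) = LinearMap.trace ℂ V z := by
  rw [adjoint, LinearMap.comp_apply, LinearEquiv.coe_coe, LinearMap.trace_conj',
    LinearMap.trace_transpose']

/-- Here `θ` is an anti-automorphism preserving the trace, with `θ(x) = -x`. -/
theorem trace_adjoint_mul_skew (z : Module.End ℂ V) {x : Module.End ℂ V}
    (hx : ∀ v w, β (x v) w = -β v (x w)) :
    LinearMap.trace ℂ V (adjoint β hβ z * x) = -LinearMap.trace ℂ V (z * x) := by
  have h : adjoint β hβ z * x = -adjoint β hβ (x * z) := by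
    refine LinearMap.ext fun v => form_ext hβ fun w => ?_
    simp only [Module.End.mul_apply, LinearMap.neg_apply, map_neg, form_adjoint_left, hx]
  rw [h, map_neg, trace_adjoint, LinearMap.trace_mul_comm]

include hsym in
/-- On `V ⊗ V` the element `γ` acts as the flip minus the contraction. -/
theorem map_gammaElt_soSp :
    Algebra.TensorProduct.map (rep (skewAdjointLieSubalgebra β) V)
      (rep (skewAdjointLieSubalgebra β) V)
      (gammaElt (soSpForm β) (soSpForm_nondegenerate β hβ ε hsym)) =
      twist LinearMap.id - contr β hβ := by
  rw [map_gammaElt_eq_twist (soSpForm_nondegenerate β hβ ε hsym) (soSpForm_isSymm β)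
    (skewProj hβ hsym) fun x y => ?_]
  · have : (LieModule.toEnd ℂ (skewAdjointLieSubalgebra β) V).toLinearMap ∘ₗ skewProj hβ hsym =
        LinearMap.id - adjoint β hβ := rfl
    rw [this, twist_sub, contr]
  · have h3 : LieModule.toEnd ℂ (skewAdjointLieSubalgebra β) V y = (y : Module.End ℂ V) := rfl
    have h4 : (skewProj hβ hsym x : Module.End ℂ V) = x - adjoint β hβ x := rfl
    have h5 := trace_adjoint_mul_skew hβ x (toEnd_skew y)
    rw [h3] at h5
    rw [soSpForm_apply, h3, h4, sub_mul, map_sub, h5]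
    ring

include hsym in
/-- The Casimir element acts on `V` by the scalar `dim V - ε`. -/
theorem rep_casimir_soSp : rep (skewAdjointLieSubalgebra β) V
    (casimir (soSpForm β) (soSpForm_nondegenerate β hβ ε hsym)) =
      ((Module.finrank ℂ V : ℂ) - ((ε : ℤ) : ℂ)) • (1 : Module.End ℂ V) := by
  have h := congrArg (LinearMap.mul' ℂ (Module.End ℂ V)) (map_gammaElt_soSp hβ hsym)
  simp only [gammaElt, map_sum, map_sub, Algebra.TensorProduct.map_tmul, contr, twist,
    LinearMap.mul'_apply, LinearMap.id_apply, sum_matUnit_mul_matUnit,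
    sum_adjoint_matUnit_mul_matUnit hβ hsym] at h
  rw [sub_smul, ← h, casimir, map_sum]
  simp only [map_mul]

variable {M : Type*} [AddCommGroup M] [Module ℂ M]
variable {k : ℕ}

/-- The contraction of two factors `V` of `M ⊗ V^{⊗ k}`. -/
def contrOp (M : Type*) [AddCommGroup M] [Module ℂ M] {V : Type*} [AddCommGroup V] [Module ℂ V]
    [FiniteDimensional ℂ V] {β : LinearMap.BilinForm ℂ V} (hβ : β.Nondegenerate) {k : ℕ}
    {i j : Fin k} (h : i ≠ j) : Module.End ℂ (TSpace M V k) :=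
  factor₂ M V h (contr β hβ)

section

variable {i j : Fin k} (h : i ≠ j)

theorem contrOp_mul_left (x : Module.End ℂ V) :
    contrOp M hβ h * factor M V i x * contrOp M hβ h =
      LinearMap.trace ℂ V x • contrOp M hβ h := by
  have := congrArg (factor₂ M V h) (contr_mul_left_mul_contr hβ x)
  simpa only [contrOp, map_mul, map_smul, factor₂_tmul, factor_one, mul_one] using this

theorem contrOp_mul_right (x : Module.End ℂ V) :
    contrOp M hβ h * factor M V j x * contrOp M hβ h =
      LinearMap.trace ℂ V x • contrOp M hβ h := by
  have := congrArg (factor₂ M V h) (contr_mul_right_mul_contr hβ x)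
  simpa only [contrOp, map_mul, map_smul, factor₂_tmul, factor_one, one_mul] using this

theorem contrOp_mul_skew {x : Module.End ℂ V} (hx : ∀ v w, β (x v) w = -β v (x w)) :
    contrOp M hβ h * factor M V i x = -(contrOp M hβ h * factor M V j x) := by
  have := congrArg (factor₂ M V h) (contr_mul_skew hβ hx)
  simpa only [contrOp, map_mul, map_neg, factor₂_tmul, factor_one, one_mul, mul_one] using this

theorem skew_mul_contrOp {x : Module.End ℂ V} (hx : ∀ v w, β (x v) w = -β v (x w)) :
    factor M V i x * contrOp M hβ h = -(factor M V j x * contrOp M hβ h) := by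
  have := congrArg (factor₂ M V h) (skew_mul_contr hβ hx)
  simpa only [contrOp, map_mul, map_neg, factor₂_tmul, factor_one, one_mul, mul_one] using this

include hsym in
theorem contrOp_mul_permOp : contrOp M hβ h * permOp M V (Equiv.swap i j) =
    ((ε : ℤ) : ℂ) • contrOp M hβ h := by
  rw [← factor₂_twist_id h, contrOp, ← map_mul, contr_mul_twist_id hβ hsym, map_smul]

include hsym in
theorem permOp_mul_contrOp : permOp M V (Equiv.swap i j) * contrOp M hβ h =
    ((ε : ℤ) : ℂ) • contrOp M hβ h := by
  rw [← factor₂_twist_id h, contrOp, ← map_mul, twist_id_mul_contr hβ hsym, map_smul]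

theorem factor_commute_contrOp {n : Fin k} (hi : n ≠ i) (hj : n ≠ j) (x : Module.End ℂ V) :
    Commute (factor M V n x) (contrOp M hβ h) := by
  rw [contrOp]
  induction contr β hβ using TensorProduct.induction_on with
  | zero => rw [map_zero]; exact Commute.zero_right _
  | tmul u v =>
    rw [factor₂_tmul]; exact (factor_commute hi _ _).mul_right (factor_commute hj _ _)
  | add a b ha hb => rw [map_add]; exact ha.add_right hb

end

variable [LieRingModule (skewAdjointLieSubalgebra β) M]
  [LieModule ℂ (skewAdjointLieSubalgebra β) M]

local notation "𝔤" => skewAdjointLieSubalgebra β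

section

variable {i j : Fin k} (h : i ≠ j)

theorem slot_commute_contrOp {n : Fin (k + 1)} (hi : n ≠ i.succ) (hj : n ≠ j.succ) (u : U 𝔤) :
    Commute (slot 𝔤 M V n u) (contrOp M hβ h) := by
  rw [contrOp]
  induction contr β hβ using TensorProduct.induction_on with
  | zero => rw [map_zero]; exact Commute.zero_right _
  | tmul u v =>
    rw [factor₂_tmul]
    cases n using Fin.cases with
    | zero =>
      exact (slot_zero_commute_factor _ _ _).mul_right (slot_zero_commute_factor _ _ _)
    | succ n =>
      rw [slot_succ]
      exact (factor_commute (fun e => hi (congrArg _ e)) _ _).mul_right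
        (factor_commute (fun e => hj (congrArg _ e)) _ _)
  | add a b ha hb => rw [map_add]; exact ha.add_right hb

theorem slot_mul_contrOp (x : 𝔤) : slot 𝔤 M V i.succ (ι x) * contrOp M hβ h =
    -(slot 𝔤 M V j.succ (ι x) * contrOp M hβ h) := by
  rw [slot_succ, slot_succ, rep_ι]
  exact skew_mul_contrOp hβ h (toEnd_skew x)

theorem contrOp_mul_slot (x : 𝔤) : contrOp M hβ h * slot 𝔤 M V i.succ (ι x) =
    -(contrOp M hβ h * slot 𝔤 M V j.succ (ι x)) := by
  rw [slot_succ, slot_succ, rep_ι]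
  exact contrOp_mul_skew hβ h (toEnd_skew x)

variable (hF : (soSpForm β).Nondegenerate)

theorem slot₂_add_mul_contrOp {n : Fin (k + 1)} :
    (slot₂ 𝔤 M V n i.succ (gammaElt (soSpForm β) hF) +
      slot₂ 𝔤 M V n j.succ (gammaElt (soSpForm β) hF)) * contrOp M hβ h = 0 := by
  rw [slot₂_gammaElt, slot₂_gammaElt, ← Finset.sum_add_distrib, Finset.sum_mul]
  refine Finset.sum_eq_zero fun a _ => ?_
  rw [← mul_add, mul_assoc, add_mul, slot_mul_contrOp, neg_add_cancel, mul_zero]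

theorem contrOp_mul_slot₂_add {n : Fin (k + 1)} (hi : n ≠ i.succ) (hj : n ≠ j.succ) :
    contrOp M hβ h * (slot₂ 𝔤 M V n i.succ (gammaElt (soSpForm β) hF) +
      slot₂ 𝔤 M V n j.succ (gammaElt (soSpForm β) hF)) = 0 := by
  rw [slot₂_gammaElt, slot₂_gammaElt, ← Finset.sum_add_distrib, Finset.mul_sum]
  refine Finset.sum_eq_zero fun a _ => ?_
  rw [← mul_add, ← mul_assoc, ← (slot_commute_contrOp hβ h hi hj _).eq, mul_assoc, mul_add,
    contrOp_mul_slot, neg_add_cancel, mul_zero]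

theorem slot₂_mul_contrOp : slot₂ 𝔤 M V i.succ j.succ (gammaElt (soSpForm β) hF) *
    contrOp M hβ h = -(slot 𝔤 M V i.succ (casimir (soSpForm β) hF) * contrOp M hβ h) := by
  rw [slot₂_gammaElt, slot_casimir, Finset.sum_mul, Finset.sum_mul, ← Finset.sum_neg_distrib]
  refine Finset.sum_congr rfl fun a _ => ?_
  rw [mul_assoc, mul_assoc, slot_mul_contrOp, TSpace.end_mul_neg, neg_neg]

theorem contrOp_mul_slot₂ : contrOp M hβ h *
    slot₂ 𝔤 M V i.succ j.succ (gammaElt (soSpForm β) hF) =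
      -(contrOp M hβ h * slot 𝔤 M V j.succ (casimir (soSpForm β) hF)) := by
  rw [slot₂_gammaElt, slot_casimir, Finset.mul_sum, Finset.mul_sum, ← Finset.sum_neg_distrib]
  refine Finset.sum_congr rfl fun a _ => ?_
  rw [← mul_assoc, ← mul_assoc, contrOp_mul_slot, TSpace.end_neg_mul]

end

/-- Between two contractions an element of `U𝔤 ⊗ End(V)` is replaced by its partial trace. -/
theorem contrOp_mul_slotFactor_mul {i j : Fin k} (h : i ≠ j) (T : U 𝔤 ⊗[ℂ] Module.End ℂ V) :
    contrOp M hβ h * slotFactor 𝔤 M V i T * contrOp M hβ h =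
      slot 𝔤 M V 0 (partialTrace 𝔤 V T) * contrOp M hβ h := by
  induction T using TensorProduct.induction_on with
  | zero => rw [map_zero, map_zero, map_zero, mul_zero, zero_mul]
  | tmul u x =>
    rw [slotFactor_tmul, ← mul_assoc,
      ← (slot_commute_contrOp hβ h (Fin.succ_ne_zero i).symm (Fin.succ_ne_zero j).symm u).eq,
      mul_assoc, mul_assoc, ← mul_assoc (contrOp M hβ h), contrOp_mul_left, partialTrace_tmul,
      map_smul, mul_smul_comm, smul_mul_assoc]
  | add a b ha hb => rw [map_add, map_add, map_add, mul_add, add_mul, add_mul, ha, hb]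

include hsym in
theorem slot_casimir_soSp (j : Fin k) :
    slot 𝔤 M V j.succ (casimir (soSpForm β) (soSpForm_nondegenerate β hβ ε hsym)) =
      ((Module.finrank ℂ V : ℂ) - ((ε : ℤ) : ℂ)) • 1 := by
  rw [slot_succ, rep_casimir_soSp hβ hsym, map_smul, factor_one]

variable [NeZero k]

section

variable (hs : (soSpForm β).IsSymm)
  (hi : ∀ x y z, soSpForm β ⁅x, y⁆ z = soSpForm β x ⁅y, z⁆)

include hsym

local notation "Φ" => tensorRep M V k (soSpForm_nondegenerate β hβ ε hsym) hs hi 0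

/-- Since `γ = s - Q` with `s` the flip, `e_i` acts as `1 - (s - Q) s = Q s = ε Q`. -/
theorem tensorRep_e_soSp (i : ℕ) (h : i + 1 < k) : (Φ (Braid.e _ i h)).val =
    ((ε : ℤ) : ℂ) • contrOp M hβ
      (show (⟨i, by omega⟩ : Fin k) ≠ ⟨i + 1, h⟩ by simp) := by
  have hne : (⟨i, by omega⟩ : Fin k) ≠ ⟨i + 1, h⟩ := by simp
  rw [tensorRep_e, slot₂_succ_succ hne, map_gammaElt_soSp hβ hsym, map_sub, factor₂_twist_id,
    map_zero, zero_add, sub_mul]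
  have h1 : permOp M V (Equiv.swap ⟨i, by omega⟩ ⟨i + 1, h⟩) * permOp M V (adj i h) = 1 := by
    rw [← permHom_apply, ← permHom_apply, ← map_mul]
    exact (congrArg _ (adj_mul_adj i h)).trans (map_one _)
  rw [h1, sub_sub_cancel]
  exact contrOp_mul_permOp hβ hsym hne

theorem tensorRep_y_soSp (j : Fin k) : (Φ (Braid.y _ j)).val =
    (((Module.finrank ℂ V : ℂ) - ((ε : ℤ) : ℂ)) / 2) • 1 +
      ∑ ℓ : Fin (k + 1) with ℓ < j.succ, slot₂ 𝔤 M V ℓ j.succ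
        (gammaElt (soSpForm β) (soSpForm_nondegenerate β hβ ε hsym)) := by
  rw [tensorRep_y]
  simp only [map_zero, zero_add]
  congr 1
  rw [slot_succ, rep_casimir_soSp hβ hsym, map_smul, factor_one, smul_smul]
  congr 1
  ring

/-- For each `ℓ < i` the sum `γ_{ℓ,i} + γ_{ℓ,i+1}` kills the contraction, and `γ_{i,i+1}` acts on
it by `-κ_i`, which cancels `½ κ_i + ½ κ_{i+1}`. -/
theorem y_add_mul_contrOp (i : ℕ) (h : i + 1 < k) :
    (Φ (Braid.y _ ⟨i, by omega⟩ + Braid.y _ ⟨i + 1, h⟩)).val *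
      contrOp M hβ (show (⟨i, by omega⟩ : Fin k) ≠ ⟨i + 1, h⟩ by simp) = 0 := by
  rw [map_add, Subalgebra.coe_add, tensorRep_y_soSp hβ hsym hs hi, tensorRep_y_soSp hβ hsym hs hi,
    sum_filter_lt_succ _ i h, add_add_add_comm, add_left_comm (∑ _ with _, _),
    ← Finset.sum_add_distrib, add_mul, add_mul, add_mul, slot₂_mul_contrOp,
    slot_casimir_soSp hβ hsym, Finset.sum_mul,
    Finset.sum_eq_zero fun ℓ _ => slot₂_add_mul_contrOp hβ _ _]
  rw [smul_one_mul, smul_one_mul]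
  module

theorem contrOp_mul_y_add (i : ℕ) (h : i + 1 < k) :
    contrOp M hβ (show (⟨i, by omega⟩ : Fin k) ≠ ⟨i + 1, h⟩ by simp) *
      (Φ (Braid.y _ ⟨i, by omega⟩ + Braid.y _ ⟨i + 1, h⟩)).val = 0 := by
  rw [map_add, Subalgebra.coe_add, tensorRep_y_soSp hβ hsym hs hi, tensorRep_y_soSp hβ hsym hs hi,
    sum_filter_lt_succ _ i h, add_add_add_comm, add_left_comm (∑ _ with _, _),
    ← Finset.sum_add_distrib, mul_add, mul_add, mul_add, contrOp_mul_slot₂,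
    slot_casimir_soSp hβ hsym, Finset.mul_sum,
    Finset.sum_eq_zero fun ℓ hℓ => contrOp_mul_slot₂_add hβ _ _ (Finset.mem_filter.1 hℓ).2.ne
      ((Finset.mem_filter.1 hℓ).2.trans (by simp [Fin.lt_def])).ne]
  rw [mul_smul_one, mul_smul_one]
  module

/-- The element `y_1` acts as `½ y + γ ∈ U𝔤 ⊗ End(V)`. -/
theorem tensorRep_y_zero (h : 0 < k) : (Φ (Braid.y _ ⟨0, h⟩)).val =
    slotFactor 𝔤 M V ⟨0, h⟩ ((((Module.finrank ℂ V : ℂ) - ((ε : ℤ) : ℂ)) / 2) • 1 +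
      Algebra.TensorProduct.map (AlgHom.id ℂ (U 𝔤)) (rep 𝔤 V)
        (gammaElt (soSpForm β) (soSpForm_nondegenerate β hβ ε hsym))) := by
  have h1 : (Finset.univ.filter fun ℓ : Fin (k + 1) => ℓ < Fin.succ ⟨0, h⟩) = {0} := by
    ext ℓ
    rw [Finset.mem_filter, Finset.mem_singleton, Fin.lt_def, Fin.ext_iff, Fin.val_succ,
      Fin.val_zero]
    simp
  rw [tensorRep_y_soSp hβ hsym hs hi, h1, Finset.sum_singleton, map_add, map_smul, slotFactor_one]
  congr 1
  simp only [gammaElt, map_sum, slot₂_tmul, Algebra.TensorProduct.map_tmul, AlgHom.id_apply,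
    slotFactor_tmul, slot_succ]

/-- The relations of `𝓦_k` hold because each `e_i` acts as `ε` times a contraction. -/
theorem factorsBMW_soSp {y : ℂ} (hy : y = (Module.finrank ℂ V : ℂ) - ((ε : ℤ) : ℂ))
    (hz : ∀ ℓ, zParam V (soSpForm β) (soSpForm_nondegenerate β hβ ε hsym) ε y ℓ ∈
      Subalgebra.center ℂ (U 𝔤)) : FactorsBMW ε (fun ℓ => ⟨_, hz ℓ⟩) Φ := by
  have hsmul (a : Braid (Z 𝔤) k) : (Φ ((ε : ℤ) • a)).val = ((ε : ℤ) : ℂ) • (Φ a).val := by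
    rw [map_zsmul]
    exact (Int.cast_smul_eq_zsmul ℂ (ε : ℤ) (Φ a).val).symm
  refine FactorsBMW.of_rel fun x y hxy => Subtype.ext ?_
  cases hxy with
  | e_t i h =>
    rw [map_mul, Subalgebra.coe_mul, hsmul, tensorRep_e_soSp hβ hsym hs hi, tensorRep_t,
      smul_mul_assoc, adj, contrOp_mul_permOp hβ hsym]
  | t_e i h =>
    rw [map_mul, Subalgebra.coe_mul, hsmul, tensorRep_e_soSp hβ hsym hs hi, tensorRep_t,
      mul_smul_comm, adj, permOp_mul_contrOp hβ hsym]
  | e_t_pred_e i h =>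
    rw [map_mul, map_mul, Subalgebra.coe_mul, Subalgebra.coe_mul, hsmul,
      tensorRep_e_soSp hβ hsym hs hi, tensorRep_t, smul_mul_assoc, smul_mul_assoc, mul_smul_comm,
      adj, mul_permOp_swap_mul (by simp) (fun x => ?_) (fun x => contrOp_mul_left hβ _ x)]
    exact (factor_commute_contrOp hβ _ (by simp) (by simp; omega) x).symm
  | e_t_succ_e i h =>
    rw [map_mul, map_mul, Subalgebra.coe_mul, Subalgebra.coe_mul, hsmul,
      tensorRep_e_soSp hβ hsym hs hi, tensorRep_t, smul_mul_assoc, smul_mul_assoc, mul_smul_comm,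
      adj, Equiv.swap_comm, mul_permOp_swap_mul (by simp) (fun x => ?_)
        (fun x => contrOp_mul_right hβ _ x)]
    exact (factor_commute_contrOp hβ _ (by simp; omega) (by simp) x).symm
  | e_y_pow_e h ℓ =>
    rw [map_mul, map_mul, map_pow, Subalgebra.coe_mul, Subalgebra.coe_mul, Subalgebra.coe_pow,
      tensorRep_y_zero hβ hsym hs hi, ← slotFactor_pow, Algebra.smul_def, map_mul,
      Subalgebra.coe_mul, tensorRep_scalar, tensorRep_e_soSp hβ hsym hs hi, smul_mul_assoc, smul_mul_assoc,
      mul_smul_comm, mul_smul_comm, contrOp_mul_slotFactor_mul,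
      ← smul_mul_assoc _ (slot 𝔤 M V 0 _),
      ← map_smul, ← hy, Int.cast_smul_eq_zsmul]
    rfl
  | e_y_add i h =>
    rw [map_mul, Subalgebra.coe_mul, tensorRep_e_soSp hβ hsym hs hi, smul_mul_assoc,
      contrOp_mul_y_add hβ hsym hs hi, smul_zero, map_zero]
    rfl
  | y_add_e i h =>
    rw [map_mul, Subalgebra.coe_mul, tensorRep_e_soSp hβ hsym hs hi, mul_smul_comm,
      y_add_mul_contrOp hβ hsym hs hi, smul_zero, map_zero]
    rfl

end

end SoSp

end

end DegBMW

open DegBMW in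
theorem mainTheorem3 (r k : ℕ) [NeZero k] (V : Type*) [AddCommGroup V] [Module ℂ V]
    [FiniteDimensional ℂ V] :
    -- the orthogonal and symplectic Lie algebras
    (∀ (X : Family) (β : LinearMap.BilinForm ℂ V) (hβ : β.Nondegenerate)
      (hsym : ∀ v w, β v w = ((X.sign : ℤ) : ℂ) * β w v)
      (_ : Module.finrank ℂ V = X.dim r)
      (M : Type*) [AddCommGroup M] [Module ℂ M] [LieRingModule (skewAdjointLieSubalgebra β) M]
      [LieModule ℂ (skewAdjointLieSubalgebra β) M],
      ∃ (hz : ∀ ℓ : ℕ,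
          zParam V (soSpForm β) (soSpForm_nondegenerate β hβ X.sign hsym) X.sign (X.y r) ℓ ∈
            Subalgebra.center ℂ (UniversalEnvelopingAlgebra ℂ (skewAdjointLieSubalgebra β)))
        (Φ : Braid (Z (skewAdjointLieSubalgebra β)) k →+*
          EndU (skewAdjointLieSubalgebra β) M V k),
        IsTensorRep (soSpForm β) (soSpForm_nondegenerate β hβ X.sign hsym) Φ ∧
        FactorsBMW X.sign (fun ℓ => ⟨_, hz ℓ⟩) Φ) ∧
    -- the general linear Lie algebra
    (∀ (_ : Module.finrank ℂ V = r)
      (M : Type*) [AddCommGroup M] [Module ℂ M] [LieRingModule (Module.End ℂ V) M]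
      [LieModule ℂ (Module.End ℂ V) M],
      ∃ Φ : Braid (Z (Module.End ℂ V)) k →+* EndU (Module.End ℂ V) M V k,
        IsTensorRep (glForm V) glForm_nondegenerate Φ ∧
        ∀ (ε : ℤˣ) (z : ℕ → Z (Module.End ℂ V)), FactorsHecke ε z Φ) ∧
    -- the special linear Lie algebra
    (∀ (_ : 0 < r) (_ : Module.finrank ℂ V = r)
      (M : Type*) [AddCommGroup M] [Module ℂ M] [LieRingModule (sl V) M]
      [LieModule ℂ (sl V) M],
      ∃ Φ Φ' : Braid (Z (sl V)) k →+* EndU (sl V) M V k,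
        IsTensorRep (slForm V) slForm_nondegenerate Φ ∧
        IsShift (1 / (r : ℂ)) Φ Φ' ∧
        ∀ (ε : ℤˣ) (z : ℕ → Z (sl V)), FactorsHecke ε z Φ') := by
  refine ⟨fun X β hβ hsym hdim M _ _ _ _ => ?_, fun hr M _ _ _ _ => ?_,
    fun hpos hr M _ _ _ _ => ?_⟩
  · have hs := soSpForm_isSymm β
    have hi := soSpForm_lie β
    refine ⟨zParam_mem_center _ hs hi _ _,
      tensorRep M V k (soSpForm_nondegenerate β hβ X.sign hsym) hs hi 0,
      isTensorRep _ hs hi, factorsBMW_soSp hβ hsym hs hi ?_ _⟩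
    rw [hdim]
    cases X <;> simp [Family.y, Family.sign, Family.dim]
  · refine ⟨tensorRep M V k glForm_nondegenerate glForm_isSymm glForm_lie 0, isTensorRep _ _ _,
      factorsHecke_tensorRep _ _ _ _ ?_⟩
    rw [zero_smul, zero_add, map_gammaElt_gl]
  · subst hr
    have : Nontrivial V := Module.nontrivial_of_finrank_pos hpos
    exact ⟨tensorRep M V k slForm_nondegenerate slForm_isSymm slForm_lie 0,
      tensorRep M V k slForm_nondegenerate slForm_isSymm slForm_lie _, isTensorRep _ _ _,
      isShift _ _ _ _, factorsHecke_tensorRep _ _ _ _ map_gammaElt_sl⟩
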